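/- **Setting.** For $\alpha\in[0,1)$ let $J(d)=d^{-2+\alpha}$, $d\ge 1$ (so $J(1)=1$). For integers $L\ge1$ put $$W_\alpha(L)=\sum_{x=1}^{L}\Big[\sum_{y\in[-L+1,0]\cup[L+1,2L]}J(|x-y|)-\sum_{y\in(-\infty,-L]\cup[2L+1,\infty)}J(|x-y|)\Big],\qquad \chi_\alpha(L)=\begin{cases}L^\alpha,&\alpha>0,\\ \log L+4,&\alpha=0,\end{cases}$$ where $x,y$ range over integers. *Triangles.* For each $i\in\mathbb Z+\frac12$ fix $r_i\in[i-\frac1{100},i+\frac1{100}]$ such that $|r_{i_1}-r_{i_2}|\neq|r_{i_3}-r_{i_4}|$ for any four distinct indices. Let $N\ge1$, $\Lambda=[-N,N]$, and let $\sigma\in\{-1,1\}^{\mathbb Z}$ satisfy $\sigma_x=+1$ for $x\notin\Lambda$. Starting from the finite set of flip points $i\in\mathbb Z+\frac12$ (those with $\sigma_{i-1/2}\ne\sigma_{i+1/2}$), repeatedly take two remaining flip points $i<j$ with $|r_i-r_j|$ minimal, form the triangle $T$ with base $\Delta(T)=[i,j]\cap\mathbb Z$ and roots $i,j$, and delete $i,j$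 (if the minimum is attained by several pairs, any of them may be taken). The resulting set of triangles is $\underline T(\sigma)$; the families arising in this way are called compatible. Write $|T|=|\Delta(T)|$, let $d(T,T')$ be the distance between the root sets of $T$ and $T'$, and for a finite set $\Gamma$ of triangles put $\Delta(\Gamma)=\bigcup_{T\in\Gamma}\Delta(T)$, $|\Gamma|=\sum_{T\in\Gamma}|T|$, $\|\Gamma\|_\alpha=\sum_{T\in\Gamma}\chi_\alpha(|T|)$ and $d(\Gamma,\Gamma')=\min_{T\in\Gamma,T'\in\Gamma'}d(T,T')$. *Contours.* For $c>1$, the contour configuration is a map assigning to each compatible family $\underline T$ a partition $\underline\Gamma(\underline T)$ of it, whose blocks are called contours, such that: (P.1) any two distinct $\Gamma,\Gamma'\in\underline\Gamma(\underline T)$ are well separated, i.e. $d(\Gamma,\Gamma')>c\min\{|\Gamma|,|\Gamma'|\}^3$ and either $\Delta(\Gamma)\cap\Delta(\Gamma')=\emptyset$ or, up to exchanging the two, $\Delta(\Gamma)\subseteq\Delta(\Gamma')$ and for each $T\in\Gamma'$ either $\Delta(\Gamma)\subseteq\Delta(T)$ or $\Delta(\Gamma)\cap\Delta(T)=\emptyset$;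 (P.2) if $\underline T^{(1)},\dots,\underline T^{(k)}$ and their union are compatible families and all distinct pairs of contours $\Gamma^{(i)}_j\in\underline\Gamma(\underline T^{(i)})$, $\Gamma^{(i')}_{j'}\in\underline\Gamma(\underline T^{(i')})$, $(i,j)\neq(i',j')$, are well separated, then $\underline\Gamma(\bigcup_i\underline T^{(i)})=\bigcup_i\underline\Gamma(\underline T^{(i)})$. *Energy.* For a finite family $\underline\Gamma$ of contours let $\sigma_x(\underline\Gamma)=(-1)^{n(x)}$, where $n(x)$ is the number of triangles $T$ in the contours of $\underline\Gamma$ with $x\in\Delta(T)$ (this is the configuration whose triangles are those of $\underline\Gamma$). Put $$H^+_\alpha(\underline\Gamma)=\frac12\sum_{x\ne y\in\mathbb Z}J(|x-y|)\mathbf 1_{\sigma_x(\underline\Gamma)\neq\sigma_y(\underline\Gamma)},\quad H^+_\alpha(\Gamma)=H^+_\alpha(\{\Gamma\}),\quad H^+_\alpha[\Gamma\,|\,\underline\Gamma\setminus\{\Gamma\}]=H^+_\alpha(\underline\Gamma)-H^+_\alpha(\underline\Gamma\setminus\{\Gamma\}).$$ **Proposition.** Let $\alpha^*\in(0,1)$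 satisfy $\sum_{n=1}^\infty n^{-(2-\alpha^*)}=2$ (numerically, $\alpha^*\approx0.2714$), and let $\alpha\in[0,\alpha^*)$. Then there is a constant $\zeta_\alpha>0$ such that $$W_\alpha(L)\ge\zeta_\alpha\,\chi_\alpha(L)\qquad\text{for all integers }L\ge1,$$ and there is $c_0=c_0(\alpha)>1$ such that for every $c\ge c_0$, every choice of $(r_i)$, every $N\ge1$, every such contour configuration map with constant $c$, every compatible family $\underline T$ and every contour $\Gamma\in\underline\Gamma=\underline\Gamma(\underline T)$, $$H^+_\alpha(\Gamma)\ge\zeta_\alpha\|\Gamma\|_\alpha\qquad\text{and}\qquad H^+_\alpha[\Gamma\,|\,\underline\Gamma\setminus\{\Gamma\}]\ge\frac{\zeta_\alpha}{2}\|\Gamma\|_\alpha .$$ -/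

import Mathlib

namespace DysonIsing

/-- The coupling `J(d) = d ^ (-2 + α)` at distance `d ≥ 1`; in particular `J(1) = 1`. -/
noncomputable def coupling (α : ℝ) (d : ℕ) : ℝ := (d : ℝ) ^ (-2 + α)

/-- `W_α(L)`: interaction of `[1, L]` with the two adjacent intervals of length `L`, minus its
interaction with everything further away. -/
noncomputable def W (α : ℝ) (L : ℕ) : ℝ :=
  ∑ x ∈ Finset.Icc (1 : ℤ) L,
    (∑ y ∈ Finset.Icc ((L : ℤ) + 1) (2 * L) ∪ Finset.Icc (-(L : ℤ) + 1) 0,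
        coupling α (x - y).natAbs
      - ∑' y : ↥(Set.Ici (2 * (L : ℤ) + 1) ∪ Set.Iic (-(L : ℤ))),
        coupling α (x - (y : ℤ)).natAbs)

/-- `χ_α(L)`: it is `L ^ α` for `α > 0`, and `log L + 4` for `α = 0`. -/
noncomputable def chi (α : ℝ) (L : ℕ) : ℝ :=
  if α = 0 then Real.log L + 4 else (L : ℝ) ^ α

/-- A triangle. The integer `i` encodes the dual site `i + 1/2`, so a triangle whose two roots
belong to the dual sites `left + 1/2 < right + 1/2` is given by two integers `left < right`. -/
structure Triangle where
  left : ℤ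
  right : ℤ
  left_lt_right : left < right
deriving DecidableEq

namespace Triangle

/-- The base `Δ(T)`: the integers between the two roots. -/
noncomputable def base (T : Triangle) : Finset ℤ := Finset.Ioc T.left T.right

/-- The mass `|T| = |Δ(T)|`. -/
noncomputable def mass (T : Triangle) : ℕ := T.base.card

/-- The distance `d(T, T')` of the two-point sets `{inf Δ(T) - 1/2, sup Δ(T) + 1/2}` and
`{inf Δ(T') - 1/2, sup Δ(T') + 1/2}`. -/
def dist (T T' : Triangle) : ℕ :=
  min (min (T.left - T'.left).natAbs (T.left - T'.right).natAbs)
    (min (T.right - T'.left).natAbs (T.right - T'.right).natAbs)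

end Triangle

/-- Spin configurations on `ℤ` with values in `{+1, -1}` that are `+1` outside `[-N, N]`. -/
def IsPlusConfig (N : ℕ) (σ : ℤ → ℤˣ) : Prop :=
  ∀ x : ℤ, x ∉ Finset.Icc (-(N : ℤ)) N → σ x = 1

/-- The spin-flip points of a configuration that is constant outside `[-N, N]`: `i` stands for
the dual site `i + 1/2`. -/
noncomputable def flips (N : ℕ) (σ : ℤ → ℤˣ) : Finset ℤ :=
  (Finset.Icc (-(N : ℤ) - 1) N).filter fun i => σ i ≠ σ (i + 1)

/-- An admissible choice of points `r i` close to the dual sites `i + 1/2`: the distances of two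
disjoint pairs are never equal. -/
def IsRootChoice (r : ℤ → ℝ) : Prop :=
  (∀ i : ℤ, r i ∈ Set.Icc ((i : ℝ) + 1 / 2 - 1 / 100) ((i : ℝ) + 1 / 2 + 1 / 100)) ∧
  ∀ i j k l : ℤ, i ≠ j → i ≠ k → i ≠ l → j ≠ k → j ≠ l → k ≠ l → |r i - r j| ≠ |r k - r l|

/-- `Grows r F τ`: starting from the lines at the points `r i`, `i ∈ F`, the process that
repeatedly joins two remaining lines at the smallest distance by a triangle and removes both of
them ends, with no line left, with the set `τ` of triangles. -/
inductive Grows (r : ℤ → ℝ) : Finset ℤ → Finset Triangle → Prop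
  | nil : Grows r ∅ ∅
  | step (F : Finset ℤ) (T : Triangle) (τ : Finset Triangle)
      (hl : T.left ∈ F) (hr : T.right ∈ F)
      (hmin : ∀ i ∈ F, ∀ j ∈ F, i ≠ j → |r T.left - r T.right| ≤ |r i - r j|)
      (h : Grows r ((F.erase T.left).erase T.right) τ) :
      Grows r F (insert T τ)

/-- A compatible family of triangles: the family `T(σ)` obtained from some spin configuration
`σ` with plus boundary condition outside `[-N, N]`. -/
def IsCompatible (r : ℤ → ℝ) (N : ℕ) (τ : Finset Triangle) : Prop :=
  ∃ σ : ℤ → ℤˣ, IsPlusConfig N σ ∧ Grows r (flips N σ) τ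

/-- Contours are finite sets of triangles (members of the partition given by `IsContourMap`). -/
abbrev Contour := Finset Triangle

namespace Contour

/-- The base `Δ(Γ)`. -/
noncomputable def base (Γ : Contour) : Finset ℤ := Γ.biUnion Triangle.base

/-- The mass `|Γ|`. -/
noncomputable def mass (Γ : Contour) : ℕ := ∑ T ∈ Γ, T.mass

/-- `Δ(Γ) ⊆ Δ(Γ')`, and `Δ(Γ)` is contained in or disjoint from the base of each triangle
of `Γ'`. -/
def Nested (Γ Γ' : Contour) : Prop :=
  base Γ ⊆ base Γ' ∧ ∀ T ∈ Γ', base Γ ⊆ T.base ∨ Disjoint (base Γ) T.base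

/-- Property P.1 for a pair of contours: the bases are disjoint or nested, and
`d(Γ, Γ') = min d(T, T') > c min (|Γ|, |Γ'|) ^ 3`. -/
def WellSeparated (c : ℝ) (Γ Γ' : Contour) : Prop :=
  (Disjoint (base Γ) (base Γ') ∨ Nested Γ Γ' ∨ Nested Γ' Γ) ∧
  ∀ T ∈ Γ, ∀ T' ∈ Γ', c * (min (mass Γ) (mass Γ') : ℝ) ^ 3 < (T.dist T' : ℝ)

end Contour

/-- `G` is the map that sends a compatible family `τ` of triangles to its configuration of
contours, for the constant `c`. Property P.0, that `G τ` is a partition of `τ`, is expressed by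
the type of `G`. -/
structure IsContourMap (c : ℝ) (r : ℤ → ℝ) (N : ℕ)
    (G : (τ : Finset Triangle) → Finpartition τ) : Prop where
  /-- P.1: distinct contours are well separated. -/
  separated : ∀ τ, IsCompatible r N τ →
    ∀ Γ ∈ (G τ).parts, ∀ Γ' ∈ (G τ).parts, Γ ≠ Γ' → Contour.WellSeparated c Γ Γ'
  /-- P.2: independence. -/
  independent : ∀ (k : ℕ) (τ : Fin k → Finset Triangle),
    (∀ i, IsCompatible r N (τ i)) → IsCompatible r N (Finset.univ.biUnion τ) →
    (∀ i, ∀ Γ ∈ (G (τ i)).parts, ∀ i', ∀ Γ' ∈ (G (τ i')).parts,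
      (i, Γ) ≠ (i', Γ') → Contour.WellSeparated c Γ Γ') →
    (G (Finset.univ.biUnion τ)).parts = Finset.univ.biUnion fun i => (G (τ i)).parts

/-- The spin configuration of a family of triangles: `+1` far away, with a spin flip exactly at
the roots of the triangles. -/
noncomputable def spin (τ : Finset Triangle) (x : ℤ) : ℤˣ := ∏ T ∈ τ, if x ∈ T.base then -1 else 1

/-- The Hamiltonian `H_α^+` without field of a family of contours, with plus boundary
condition. -/
noncomputable def energy (α : ℝ) (C : Finset Contour) : ℝ :=
  (1 / 2) * ∑' p : ℤ × ℤ,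
    if p.1 ≠ p.2 ∧ spin (C.biUnion id) p.1 ≠ spin (C.biUnion id) p.2
    then coupling α (p.1 - p.2).natAbs else 0

/-- `H_α^+[Γ | C \ {Γ}] = H_α^+(C) - H_α^+(C \ {Γ})`. -/
noncomputable def condEnergy (α : ℝ) (Γ : Contour) (C : Finset Contour) : ℝ :=
  energy α C - energy α (C \ {Γ})

/-- `‖Γ‖_α`. -/
noncomputable def contourNorm (α : ℝ) (Γ : Contour) : ℝ := ∑ T ∈ Γ, chi α T.mass

theorem Grows.roots_mem {r : ℤ → ℝ} {F : Finset ℤ} {τ : Finset Triangle} (h : Grows r F τ) :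
    ∀ T ∈ τ, T.left ∈ F ∧ T.right ∈ F := by
  induction h with
  | nil => simp
  | step F T τ hl hr hmin h ih =>
    intro T' hT'
    rcases Finset.mem_insert.1 hT' with rfl | hT'
    · exact ⟨hl, hr⟩
    · have := ih T' hT'
      simp only [Finset.mem_erase] at this
      exact ⟨this.1.2.2, this.2.2.2⟩

theorem Grows.spin_mul {r : ℤ → ℝ} {F : Finset ℤ} {τ : Finset Triangle} (h : Grows r F τ) (x : ℤ) :
    spin τ x * spin τ (x + 1) = if x ∈ F then -1 else 1 := by
  induction h with
  | nil => simp [spin]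
  | step F T τ hl hr hmin h ih =>
    have hT : T ∉ τ := by
      intro hT
      have := (h.roots_mem T hT).1
      simp at this
    have hlr := T.left_lt_right
    have key : ((if x ∈ T.base then -1 else 1) * (if x + 1 ∈ T.base then -1 else 1) : ℤˣ)
        = if x = T.left ∨ x = T.right then -1 else 1 := by
      simp only [Triangle.base, Finset.mem_Ioc]
      split_ifs <;> first | rfl | (exfalso; omega)
    have e : spin (insert T τ) x * spin (insert T τ) (x + 1)
        = ((if x ∈ T.base then -1 else 1) * (if x + 1 ∈ T.base then -1 else 1) : ℤˣ)
          * (spin τ x * spin τ (x + 1)) := by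
      simp only [spin, Finset.prod_insert hT]
      exact mul_mul_mul_comm _ _ _ _
    rw [e, key, ih]
    simp only [Finset.mem_erase]
    by_cases h1 : x = T.left
    · simp [h1, hl, hlr.ne]
    · by_cases h2 : x = T.right
      · simp [h2, hr]
      · simp [h1, h2]

/-- The spin configuration of the family of triangles of `σ` is `σ`. -/
theorem spin_eq_of_grows {r : ℤ → ℝ} {N : ℕ} {σ : ℤ → ℤˣ} {τ : Finset Triangle}
    (hσ : IsPlusConfig N σ) (h : Grows r (flips N σ) τ) : spin τ = σ := by
  have low : ∀ x : ℤ, x ≤ -(N : ℤ) - 1 → spin τ x = σ x := by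
    intro x hx
    rw [hσ x (by simp only [Finset.mem_Icc]; omega)]
    refine Finset.prod_eq_one fun T hT => if_neg ?_
    have := (h.roots_mem T hT).1
    simp only [flips, Finset.mem_filter, Finset.mem_Icc] at this
    simp only [Triangle.base, Finset.mem_Ioc]
    omega
  have step : ∀ x : ℤ, spin τ x = σ x → spin τ (x + 1) = σ (x + 1) := by
    intro x hx
    have hm := h.spin_mul x
    have hf : x ∈ flips N σ ↔ σ x ≠ σ (x + 1) := by
      simp only [flips, Finset.mem_filter, Finset.mem_Icc, and_iff_right_iff_imp]
      intro hne
      by_contra hcon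
      apply hne
      rw [hσ x (by simp only [Finset.mem_Icc]; omega),
        hσ (x + 1) (by simp only [Finset.mem_Icc]; omega)]
    rw [hx] at hm
    simp only [hf] at hm
    rcases Int.units_eq_one_or (σ x) with a | a <;>
      rcases Int.units_eq_one_or (σ (x + 1)) with b | b <;>
      rcases Int.units_eq_one_or (spin τ (x + 1)) with d | d <;>
      simp [a, b, d] at hm ⊢
  funext x
  rcases le_total x (-(N : ℤ) - 1) with hx | hx
  · exact low x hx
  · exact Int.leInduction (m := -(N : ℤ) - 1) (motive := fun x _ => spin τ x = σ x)
      (low _ le_rfl) (fun x _ hx => step x hx) x hx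

theorem Contour.Nested.mono {A A' B B' : Contour} (h : Contour.Nested A A') (hB : B ⊆ A)
    (hB' : B' ⊆ A') :
    Disjoint (Contour.base B) (Contour.base B') ∨ Contour.Nested B B' := by
  have hb : Contour.base B ⊆ Contour.base A := Finset.biUnion_subset_biUnion_of_subset_left _ hB
  have hT : ∀ T ∈ B', Contour.base B ⊆ T.base ∨ Disjoint (Contour.base B) T.base := fun T hT =>
    (h.2 T (hB' hT)).imp hb.trans (Finset.disjoint_of_subset_left hb)
  by_cases hex : ∃ T ∈ B', Contour.base B ⊆ T.base
  · obtain ⟨T, hTB, hsub⟩ := hex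
    exact Or.inr ⟨hsub.trans (Finset.subset_biUnion_of_mem Triangle.base hTB), hT⟩
  · push Not at hex
    left
    exact (Finset.disjoint_biUnion_right _ _ _).2 fun T hTB =>
      (hT T hTB).resolve_left (hex T hTB)

theorem Contour.mass_mono {A B : Contour} (h : B ⊆ A) : Contour.mass B ≤ Contour.mass A :=
  Finset.sum_le_sum_of_subset h

theorem Contour.WellSeparated.mono {c : ℝ} (hc : 0 ≤ c) {A A' B B' : Contour}
    (h : Contour.WellSeparated c A A') (hB : B ⊆ A) (hB' : B' ⊆ A') :
    Contour.WellSeparated c B B' := by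
  have hb : Contour.base B ⊆ Contour.base A := Finset.biUnion_subset_biUnion_of_subset_left _ hB
  have hb' : Contour.base B' ⊆ Contour.base A' :=
    Finset.biUnion_subset_biUnion_of_subset_left _ hB'
  refine ⟨?_, fun T hT T' hT' => lt_of_le_of_lt ?_ (h.2 T (hB hT) T' (hB' hT'))⟩
  · rcases h.1 with h1 | h1 | h1
    · exact Or.inl (Finset.disjoint_of_subset_left hb (Finset.disjoint_of_subset_right hb' h1))
    · exact (h1.mono hB hB').imp_right Or.inl
    · exact ((h1.mono hB' hB).imp_left fun h => h.symm).imp_right Or.inr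
  · have m1 : (Contour.mass B : ℝ) ≤ Contour.mass A := by exact_mod_cast Contour.mass_mono hB
    have m2 : (Contour.mass B' : ℝ) ≤ Contour.mass A' := by exact_mod_cast Contour.mass_mono hB'
    gcongr

theorem Contour.WellSeparated.disjoint {c : ℝ} (hc : 0 ≤ c) {A A' : Contour}
    (h : Contour.WellSeparated c A A') : Disjoint A A' := by
  refine Finset.disjoint_left.2 fun T hT hT' => ?_
  have := h.2 T hT T hT'
  have h0 : T.dist T = 0 := by simp [Triangle.dist]
  rw [h0] at this
  have : (0 : ℝ) ≤ c * (min (Contour.mass A) (Contour.mass A') : ℝ) ^ 3 := by positivity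
  simp only [Nat.cast_zero] at *
  linarith

/-- Every finite family of triangles has a finest partition that satisfies P.1. -/
theorem exists_finest (c : ℝ) (hc : 0 ≤ c) (τ : Finset Triangle) :
    ∃ P : Finpartition τ,
      (∀ Γ ∈ P.parts, ∀ Γ' ∈ P.parts, Γ ≠ Γ' → Contour.WellSeparated c Γ Γ') ∧
      ∀ Q : Finpartition τ,
        (∀ Γ ∈ Q.parts, ∀ Γ' ∈ Q.parts, Γ ≠ Γ' → Contour.WellSeparated c Γ Γ') → P ≤ Q := by
  classical
  let S : Set (Finpartition τ) := {P | ∀ Γ ∈ P.parts, ∀ Γ' ∈ P.parts, Γ ≠ Γ' →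
    Contour.WellSeparated c Γ Γ'}
  have hne : S.Nonempty := by
    refine ⟨⊤, fun Γ hΓ Γ' hΓ' hn => absurd ?_ hn⟩
    exact (Finpartition.parts_top_subsingleton τ) hΓ hΓ'
  obtain ⟨P, hP⟩ := (Set.toFinite S).exists_minimal hne
  refine ⟨P, hP.1, fun Q hQ => ?_⟩
  have hPQ : P ⊓ Q ∈ S := by
    intro Γ hΓ Γ' hΓ' hn
    simp only [Finpartition.parts_inf, Finset.mem_erase, Finset.mem_image, Finset.mem_product,
      Prod.exists] at hΓ hΓ'
    obtain ⟨-, A, B, ⟨hA, hB⟩, rfl⟩ := hΓ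
    obtain ⟨-, A', B', ⟨hA', hB'⟩, rfl⟩ := hΓ'
    by_cases hAA : A = A'
    · have hBB : B ≠ B' := by
        rintro rfl
        exact hn (by rw [hAA])
      exact (hQ B hB B' hB' hBB).mono hc inf_le_right inf_le_right
    · exact (hP.1 A hA A' hA' hAA).mono hc inf_le_left inf_le_left
  exact (hP.2 hPQ inf_le_left).trans inf_le_right

/-- The configuration of contours exists. -/
theorem exists_isContourMap (c : ℝ) (hc : 0 ≤ c) (r : ℤ → ℝ) (N : ℕ) :
    ∃ G : (τ : Finset Triangle) → Finpartition τ, IsContourMap c r N G := by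
  classical
  choose G hG hmin using exists_finest c hc
  refine ⟨G, fun τ _ => hG τ, fun k τ _ _ hsep => ?_⟩
  have hpart : ∀ i, ∀ Γ ∈ (G (τ i)).parts, ∀ i', ∀ Γ' ∈ (G (τ i')).parts, ∀ T ∈ Γ, T ∈ Γ' →
      Γ = Γ' := by
    intro i Γ hΓ i' Γ' hΓ' T hT hT'
    by_contra hn
    have := (hsep i Γ hΓ i' Γ' hΓ' (fun h => hn (Prod.ext_iff.1 h).2)).disjoint hc
    exact Finset.disjoint_left.1 this hT hT'
  let R : Finpartition (Finset.univ.biUnion τ) :=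
    Finpartition.ofExistsUnique (Finset.univ.biUnion fun i => (G (τ i)).parts)
      (by
        intro p hp
        obtain ⟨i, -, hp⟩ := Finset.mem_biUnion.1 hp
        exact ((G (τ i)).subset hp).trans (Finset.subset_biUnion_of_mem τ (Finset.mem_univ i)))
      (by
        intro T hT
        obtain ⟨i, -, hT⟩ := Finset.mem_biUnion.1 hT
        obtain ⟨Γ, hΓ, hTΓ⟩ := (G (τ i)).exists_mem hT
        refine ⟨Γ, ⟨Finset.mem_biUnion.2 ⟨i, Finset.mem_univ i, hΓ⟩, hTΓ⟩, ?_⟩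
        rintro Γ' ⟨hΓ', hTΓ'⟩
        obtain ⟨i', -, hΓ'⟩ := Finset.mem_biUnion.1 hΓ'
        exact hpart i' Γ' hΓ' i Γ hΓ T hTΓ' hTΓ)
      (by
        intro h
        obtain ⟨i, -, h⟩ := Finset.mem_biUnion.1 h
        exact (G (τ i)).empty_notMem_parts h)
  have hR : R.parts = Finset.univ.biUnion fun i => (G (τ i)).parts := rfl
  have hle : G (Finset.univ.biUnion τ) ≤ R := by
    refine hmin _ R fun Γ hΓ Γ' hΓ' hn => ?_
    rw [hR] at hΓ hΓ'
    obtain ⟨i, -, hΓ⟩ := Finset.mem_biUnion.1 hΓ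
    obtain ⟨i', -, hΓ'⟩ := Finset.mem_biUnion.1 hΓ'
    exact hsep i Γ hΓ i' Γ' hΓ' fun h => hn (Prod.ext_iff.1 h).2
  have hsub : R.parts ⊆ (G (Finset.univ.biUnion τ)).parts := by
    intro Γ hΓR
    have hΓ := hΓR
    rw [hR] at hΓ
    obtain ⟨i, -, hΓ⟩ := Finset.mem_biUnion.1 hΓ
    have hi : τ i ≤ Finset.univ.biUnion τ := Finset.subset_biUnion_of_mem τ (Finset.mem_univ i)
    have hres : G (τ i) ≤ (G (Finset.univ.biUnion τ)).restrict hi := by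
      refine hmin _ _ fun A hA A' hA' hn => ?_
      simp only [Finpartition.restrict, Finset.mem_erase, Finset.mem_image] at hA hA'
      obtain ⟨-, B, hB, rfl⟩ := hA
      obtain ⟨-, B', hB', rfl⟩ := hA'
      have hBB : B ≠ B' := by
        rintro rfl
        exact hn rfl
      exact (hG _ B hB B' hB' hBB).mono hc inf_le_left inf_le_left
    obtain ⟨A, hA, hΓA⟩ := hres hΓ
    simp only [Finpartition.restrict, Finset.mem_erase, Finset.mem_image] at hA
    obtain ⟨-, B, hB, rfl⟩ := hA
    obtain ⟨Γ', hΓ', hBΓ'⟩ := hle hB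
    have hΓB : Γ ⊆ B := hΓA.trans inf_le_left
    obtain ⟨T, hT⟩ := R.nonempty_of_mem_parts hΓR
    have : Γ = Γ' := R.eq_of_mem_parts hΓR hΓ' hT (hBΓ' (hΓB hT))
    have : Γ = B := Finset.Subset.antisymm hΓB (this ▸ hBΓ')
    exact this ▸ hB
  rw [← hR]
  refine Finset.Subset.antisymm (fun B hB => ?_) hsub
  obtain ⟨Γ, hΓ, hBΓ⟩ := hle hB
  obtain ⟨T, hT⟩ := (G (Finset.univ.biUnion τ)).nonempty_of_mem_parts hB
  have : B = Γ := Finpartition.eq_of_mem_parts _ hB (hsub hΓ) hT (hBΓ hT)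
  exact this ▸ hΓ

end DysonIsing

open DysonIsing

/-!
Write `t(k) = ∑_{d ≥ k} J(d)` for the tails of the coupling.

*The function `W`.* Summing the coupling over half-lines gives
`W α L = 2 ∑_{j=1}^L (t(j) - 2 t(L+j))`. For `L = 1` this is `2 (2 - ζ(2 - α))`, which is positive
exactly because `α < αs`. The increment of `W / 2` from `L` to `L + 1` is
`3 t(L+1) - 2 (t(2L+1) + t(2L+2))`; grouping the last two tails around the even integers `2e`
(`coupling_neighbours_le`) shows that it is at least a positive multiple of `t(L+1)` as long as
`α ≤ 2/5`, and `αs ≤ 2/5` because `ζ(8/5) > 2`. As `t(L+1)` dominates the increments of `chi α`, the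
bound `ζ * chi α L ≤ W α L` follows by induction (`exists_chi_le_halfW`).

*A single contour.* In the growth process the first triangle `T` is the smallest one, so the other
flip points keep a distance of at least `|T|` from its roots. Hence the spins on the two adjacent
intervals of length `|T|` are opposite to those on its base, and removing `T` lowers the energy by
at least `W α |T|` (`W_le_of_flip`). Iterating, the energy is at least `∑ W α |T|`
(`Grows.sum_W_le`). This applies to a contour since subfamilies of grown families are grown
(`Grows.subset`).

*The conditional energy.* The energy of a product of two spin configurations is the sum of their
energies minus the coupling of the ordered pairs of sites separated by both (`tsum_cut_mul`).
This mixed term is estimated in `tsum_mixed_le`. A contour of mass at least `|Γ|` has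
its roots further than `c |Γ|³` from those of `Γ`, so it only matters for pairs of sites
at a distance beyond `c |Γ|³`,
whose total coupling to the at most `|Γ|` sites of the base is small. For a contour of
mass `m < |Γ|`, the interaction of a site of its base with the other side of a triangle `T` of `Γ`
is at most four times that of any site within distance `k m³`, so it may be replaced by its average
over the interval of this radius (`potential_le_sum`). By well-separation each site is met by the
intervals of at most one contour of mass `m`, hence by at most `m` intervals of this radius
(`sum_potential_le`). Summing over `m` costs `∑ 1 / (k m²)`, and what remains is the total
interaction of the base of `T` with its complement, which is of order `chi α |T|`. Both parts
are `O(1/k)` times the norm of `Γ`, where `c ≥ 4 k²`.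
-/

namespace DysonIsing

/-! ### The coupling and its tails -/

lemma coupling_nonneg (α : ℝ) (d : ℕ) : 0 ≤ coupling α d :=
  Real.rpow_nonneg (Nat.cast_nonneg d) _

lemma coupling_one (α : ℝ) : coupling α 1 = 1 := by simp [coupling]

lemma coupling_anti {α : ℝ} (hα : α < 1) {d e : ℕ} (hd : 1 ≤ d) (h : d ≤ e) :
    coupling α e ≤ coupling α d :=
  Real.rpow_le_rpow_of_nonpos (by exact_mod_cast hd) (by exact_mod_cast h) (by linarith)

/-- Doubling the distance costs at most a factor `4`. -/
lemma coupling_le_four_mul {α : ℝ} (hα0 : 0 ≤ α) (hα : α < 1) {d e : ℕ} (he : 1 ≤ e)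
    (h : e ≤ 2 * d) : coupling α d ≤ 4 * coupling α e := by
  have hd : 1 ≤ d := by omega
  have hd' : (0 : ℝ) < d := by exact_mod_cast hd
  have h1 : coupling α (2 * d) ≤ coupling α e := coupling_anti hα he h
  have h2 : coupling α (2 * d) = (2 : ℝ) ^ (-2 + α) * coupling α d := by
    simp only [coupling]
    push_cast
    exact Real.mul_rpow (by norm_num) hd'.le
  have h3 : (1 / 4 : ℝ) ≤ (2 : ℝ) ^ (-2 + α) := by
    calc (1 / 4 : ℝ) = (2 : ℝ) ^ (-2 : ℝ) := by
          rw [Real.rpow_neg (by norm_num)]; norm_num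
      _ ≤ _ := Real.rpow_le_rpow_of_exponent_le (by norm_num) (by linarith)
  have h4 := mul_le_mul_of_nonneg_right h3 (coupling_nonneg α d)
  linarith

lemma summable_coupling {α : ℝ} (hα : α < 1) : Summable (coupling α) :=
  Real.summable_nat_rpow.2 (by linarith)

/-- The tail `∑_{d ≥ k} J(d)`. -/
noncomputable def tail (α : ℝ) (k : ℕ) : ℝ := ∑' n : ℕ, coupling α (n + k)

lemma summable_coupling_add {α : ℝ} (hα : α < 1) (k : ℕ) :
    Summable fun n : ℕ => coupling α (n + k) :=
  (summable_nat_add_iff k).2 (summable_coupling hα)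

lemma tail_nonneg (α : ℝ) (k : ℕ) : 0 ≤ tail α k := tsum_nonneg fun _ => coupling_nonneg _ _

lemma sum_range_add_tail {α : ℝ} (hα : α < 1) (k m : ℕ) :
    ∑ n ∈ Finset.range m, coupling α (n + k) + tail α (k + m) = tail α k := by
  have := (summable_coupling_add hα k).sum_add_tsum_nat_add m
  rw [tail, tail, ← this]
  congr 1
  exact tsum_congr fun n => by congr 1; ring

lemma tail_eq_add {α : ℝ} (hα : α < 1) (k : ℕ) : tail α k = coupling α k + tail α (k + 1) := by
  have := sum_range_add_tail hα k 1
  simp at this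
  linarith

lemma rpow_le_tail {α : ℝ} (hα0 : 0 ≤ α) (hα : α < 1) {k : ℕ} (hk : 1 ≤ k) :
    (k : ℝ) ^ (α - 1) / 4 ≤ tail α k := by
  have h1 := sum_range_add_tail hα k k
  have h2 : ∑ n ∈ Finset.range k, coupling α k / 4 ≤
      ∑ n ∈ Finset.range k, coupling α (n + k) := by
    refine Finset.sum_le_sum fun n hn => ?_
    have hn := Finset.mem_range.1 hn
    have := coupling_le_four_mul hα0 hα (d := k) (e := n + k) (by omega) (by omega)
    linarith
  have h3 : (k : ℝ) ^ (α - 1) = k * coupling α k := by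
    rw [coupling, ← Real.rpow_one_add' (Nat.cast_nonneg k) (by linarith)]
    congr 1; ring
  simp only [Finset.sum_const, Finset.card_range, nsmul_eq_mul] at h2
  have := tail_nonneg α (k + k)
  rw [h3]
  linarith

/-- Comparison of `J` with the increments of `d ^ (α - 1)`, from above. -/
lemma coupling_succ_le {α : ℝ} (hα0 : 0 ≤ α) (hα : α < 1) {d : ℕ} (hd : 1 ≤ d) :
    (1 - α) * coupling α (d + 1) ≤ (d : ℝ) ^ (α - 1) - ((d + 1 : ℕ) : ℝ) ^ (α - 1) := by
  have hd' : (1 : ℝ) ≤ d := by exact_mod_cast hd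
  set p := 1 - α with hp
  have e1 : ∀ x : ℝ, 0 < x → x ^ (α - 1) = 1 / x ^ p := fun x hx => by
    rw [show α - 1 = -p by ring, Real.rpow_neg hx.le, one_div]
  have e2 : coupling α (d + 1) = 1 / ((d + 1 : ℝ) * (d + 1 : ℝ) ^ p) := by
    rw [coupling, show -2 + α = -(1 + p) by rw [hp]; ring, Real.rpow_neg (by positivity),
      Real.rpow_add (by positivity), Real.rpow_one, one_div]
    push_cast; rfl
  rw [e2, e1 _ (by positivity), e1 _ (by positivity)]
  push_cast
  have hB : (d : ℝ) ^ p ≤ (d + 1 : ℝ) ^ p * (1 - p / (d + 1)) := by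
    have := rpow_one_add_le_one_add_mul_self (s := -(1 / (d + 1 : ℝ)))
      (by rw [neg_le_neg_iff, div_le_one (by positivity)]; linarith) (p := p)
      (by linarith) (by linarith)
    have h2 : (d : ℝ) = (d + 1 : ℝ) * (1 + -(1 / (d + 1 : ℝ))) := by field_simp; ring
    have h3 : (0 : ℝ) ≤ 1 + -(1 / (d + 1 : ℝ)) := by
      have : 1 / (d + 1 : ℝ) ≤ 1 := by rw [div_le_one (by positivity)]; linarith
      linarith
    calc (d : ℝ) ^ p = (d + 1 : ℝ) ^ p * (1 + -(1 / (d + 1 : ℝ))) ^ p := by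
          rw [← Real.mul_rpow (by positivity) h3, ← h2]
      _ ≤ (d + 1 : ℝ) ^ p * (1 + p * -(1 / (d + 1 : ℝ))) := by gcongr
      _ = _ := by ring
  have ha : 0 < (d : ℝ) ^ p := by positivity
  have hb : 0 < (d + 1 : ℝ) ^ p := by positivity
  set a := (d : ℝ) ^ p
  set b := (d + 1 : ℝ) ^ p
  rw [div_sub_div _ _ ha.ne' hb.ne', mul_one_div, div_le_div_iff₀ (by positivity) (by positivity)]
  have hB' : a * (d + 1) ≤ b * (d + 1 - p) := by
    calc a * (d + 1) ≤ (b * (1 - p / (d + 1))) * (d + 1) := by gcongr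
      _ = _ := by field_simp
  have hp0 : 0 < p := by linarith
  have : p * a ≤ (d + 1) * (b - a) := by
    have : p * a ≤ p * b := by
      refine mul_le_mul_of_nonneg_left ?_ hp0.le
      exact Real.rpow_le_rpow (by positivity) (by linarith) hp0.le
    linarith
  nlinarith

/-- Comparison of `J` with the increments of `d ^ (α - 1)`, from below. -/
lemma le_coupling {α : ℝ} (hα0 : 0 ≤ α) (hα : α < 1) {d : ℕ} (hd : 1 ≤ d) :
    (d : ℝ) ^ (α - 1) - ((d + 1 : ℕ) : ℝ) ^ (α - 1) ≤ (1 - α) * coupling α d := by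
  have hd' : (1 : ℝ) ≤ d := by exact_mod_cast hd
  set p := 1 - α with hp
  have e1 : ∀ x : ℝ, 0 < x → x ^ (α - 1) = 1 / x ^ p := fun x hx => by
    rw [show α - 1 = -p by ring, Real.rpow_neg hx.le, one_div]
  have e2 : coupling α d = 1 / ((d : ℝ) * (d : ℝ) ^ p) := by
    rw [coupling, show -2 + α = -(1 + p) by rw [hp]; ring, Real.rpow_neg (by positivity),
      Real.rpow_add (by positivity), Real.rpow_one, one_div]
  rw [e2, e1 _ (by positivity), e1 _ (by positivity)]
  push_cast
  have hB : (d + 1 : ℝ) ^ p ≤ (d : ℝ) ^ p * (1 + p / d) := by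
    have := rpow_one_add_le_one_add_mul_self (s := 1 / (d : ℝ))
      (by have : (0 : ℝ) ≤ 1 / d := by positivity
          linarith) (p := p)
      (by linarith) (by linarith)
    have h2 : (d + 1 : ℝ) = d * (1 + 1 / (d : ℝ)) := by field_simp
    calc (d + 1 : ℝ) ^ p = (d : ℝ) ^ p * (1 + 1 / (d : ℝ)) ^ p := by
          rw [← Real.mul_rpow (by positivity) (by positivity), ← h2]
      _ ≤ (d : ℝ) ^ p * (1 + p * (1 / (d : ℝ))) := by gcongr
      _ = _ := by ring
  have ha : 0 < (d : ℝ) ^ p := by positivity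
  have hb : 0 < (d + 1 : ℝ) ^ p := by positivity
  have hab : (d : ℝ) ^ p ≤ (d + 1 : ℝ) ^ p :=
    Real.rpow_le_rpow (by positivity) (by linarith) (by linarith)
  set a := (d : ℝ) ^ p
  set b := (d + 1 : ℝ) ^ p
  rw [div_sub_div _ _ ha.ne' hb.ne', mul_one_div, div_le_div_iff₀ (by positivity) (by positivity)]
  have hB' : b * d ≤ a * (d + p) := by
    calc b * d ≤ (a * (1 + p / d)) * d := by gcongr
      _ = _ := by field_simp
  have hp0 : 0 < p := by linarith
  have : p * a ≤ p * b := by gcongr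
  nlinarith

/-- The telescoping comparison of `coupling_succ_le`, summed from `k` on. -/
lemma tail_le_rpow {α : ℝ} (hα0 : 0 ≤ α) (hα : α < 1) {k : ℕ} (hk : 1 ≤ k) :
    tail α k ≤ (1 + 1 / (1 - α)) * (k : ℝ) ^ (α - 1) := by
  have hk' : (1 : ℝ) ≤ k := by exact_mod_cast hk
  have hp : 0 < 1 - α := by linarith
  have h1 : tail α (k + 1) ≤ (k : ℝ) ^ (α - 1) / (1 - α) := by
    refine Real.tsum_le_of_sum_range_le (fun _ => coupling_nonneg _ _) fun n => ?_
    rw [le_div_iff₀ hp, Finset.sum_mul]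
    have : ∀ m, ∑ i ∈ Finset.range m, coupling α (i + (k + 1)) * (1 - α) ≤
        (k : ℝ) ^ (α - 1) - ((k + m : ℕ) : ℝ) ^ (α - 1) := by
      intro m
      induction m with
      | zero => simp
      | succ m ih =>
        rw [Finset.sum_range_succ]
        have := coupling_succ_le hα0 hα (d := k + m) (by omega)
        rw [show m + (k + 1) = k + m + 1 by ring, show k + (m + 1) = k + m + 1 by ring]
        linarith
    have h2 : (0 : ℝ) ≤ ((k + n : ℕ) : ℝ) ^ (α - 1) := by positivity
    linarith [this n]
  have h2 : coupling α k ≤ (k : ℝ) ^ (α - 1) :=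
    Real.rpow_le_rpow_of_exponent_le hk' (by linarith)
  rw [tail_eq_add hα]
  calc _ ≤ (k : ℝ) ^ (α - 1) + (k : ℝ) ^ (α - 1) / (1 - α) := add_le_add h2 h1
    _ = _ := by ring

/-! ### The normalization `chi` -/

lemma one_le_chi {α : ℝ} (hα0 : 0 ≤ α) {L : ℕ} (hL : 1 ≤ L) : 1 ≤ chi α L := by
  have hL' : (1 : ℝ) ≤ L := by exact_mod_cast hL
  unfold chi
  split_ifs with h
  · linarith [Real.log_nonneg hL']
  · exact Real.one_le_rpow hL' hα0

lemma chi_one_le (α : ℝ) : chi α 1 ≤ 4 := by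
  unfold chi
  split_ifs with h <;> simp

lemma chi_succ_le {α : ℝ} (hα0 : 0 ≤ α) (hα : α < 1) {L : ℕ} (hL : 1 ≤ L) :
    chi α (L + 1) - chi α L ≤ 2 * ((L + 1 : ℕ) : ℝ) ^ (α - 1) := by
  have hL' : (1 : ℝ) ≤ L := by exact_mod_cast hL
  have key : (1 : ℝ) / L ≤ 2 * (1 / (L + 1)) := by
    rw [mul_one_div, div_le_div_iff₀ (by positivity) (by positivity)]; linarith
  unfold chi
  split_ifs with h
  · subst h
    have h1 : Real.log ((L + 1 : ℕ) : ℝ) - Real.log L ≤ 1 / L := by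
      rw [← Real.log_div (by positivity) (by positivity)]
      refine (Real.log_le_sub_one_of_pos (by positivity)).trans (le_of_eq ?_)
      push_cast; field_simp; ring
    rw [zero_sub, Real.rpow_neg_one, ← one_div]
    push_cast at h1 ⊢
    linarith
  · have h2 : (L + 1 : ℝ) = L * (1 + 1 / (L : ℝ)) := by field_simp
    have h0 : (0 : ℝ) ≤ 1 / (L : ℝ) := by positivity
    have h3 : (L + 1 : ℝ) ^ α ≤ L ^ α * (1 + α * (1 / L)) := by
      rw [h2, Real.mul_rpow (by positivity) (by positivity)]
      gcongr
      exact rpow_one_add_le_one_add_mul_self (by linarith) hα0 hα.le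
    have h4 : (L : ℝ) ^ α ≤ (L + 1 : ℝ) ^ α := Real.rpow_le_rpow (by positivity) (by linarith) hα0
    have h5 : ((L + 1 : ℝ)) ^ (α - 1) = (L + 1 : ℝ) ^ α * (1 / (L + 1)) := by
      rw [Real.rpow_sub_one (by positivity)]; ring
    push_cast
    rw [h5]
    have h6 : (L : ℝ) ^ α * (α * (1 / L)) ≤ (L + 1 : ℝ) ^ α * (1 * (1 / L)) := by gcongr
    have h7 : (L + 1 : ℝ) ^ α * (1 / L) ≤ (L + 1 : ℝ) ^ α * (2 * (1 / (L + 1))) := by gcongr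
    linarith

lemma le_chi_succ {α : ℝ} (hα0 : 0 ≤ α) (hα : α < 1) {L : ℕ} (hL : 1 ≤ L) :
    (if α = 0 then 1 else α) * ((L + 1 : ℕ) : ℝ) ^ (α - 1) ≤ chi α (L + 1) - chi α L := by
  have hL' : (1 : ℝ) ≤ L := by exact_mod_cast hL
  unfold chi
  split_ifs with h
  · subst h
    have h1 : 1 / (L + 1 : ℝ) ≤ Real.log ((L + 1 : ℕ) : ℝ) - Real.log L := by
      rw [← Real.log_div (by positivity) (by positivity)]
      refine le_trans (le_of_eq ?_) (Real.one_sub_inv_le_log_of_pos (by positivity))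
      push_cast; field_simp; ring
    rw [zero_sub, Real.rpow_neg_one, ← one_div]
    push_cast at h1 ⊢
    linarith
  · have h2 : (L : ℝ) = (L + 1 : ℝ) * (1 + -(1 / (L + 1 : ℝ))) := by field_simp; ring
    have h0 : 1 / (L + 1 : ℝ) ≤ 1 := by rw [div_le_one (by positivity)]; linarith
    have h3 : (L : ℝ) ^ α ≤ (L + 1 : ℝ) ^ α * (1 + α * -(1 / (L + 1))) := by
      calc (L : ℝ) ^ α = (L + 1 : ℝ) ^ α * (1 + -(1 / (L + 1 : ℝ))) ^ α := by
            rw [← Real.mul_rpow (by positivity) (by linarith), ← h2]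
        _ ≤ _ := by
            gcongr
            exact rpow_one_add_le_one_add_mul_self (by linarith) hα0 hα.le
    have h5 : ((L + 1 : ℝ)) ^ (α - 1) = (L + 1 : ℝ) ^ α * (1 / (L + 1)) := by
      rw [Real.rpow_sub_one (by positivity)]; ring
    push_cast
    rw [h5]
    linarith

/-- The interaction of a half-line with the `L` sites next to it is at most of order
`chi α L`. -/
lemma exists_sum_tail_le {α : ℝ} (hα0 : 0 ≤ α) (hα : α < 1) :
    ∃ C : ℝ, 0 < C ∧ ∀ L : ℕ, 1 ≤ L →
      ∑ j ∈ Finset.range L, tail α (j + 1) ≤ C * chi α L := by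
  have hκ : (0 : ℝ) < if α = 0 then 1 else α := by
    split_ifs with h
    · norm_num
    · exact lt_of_le_of_ne hα0 (Ne.symm h)
  set κ : ℝ := if α = 0 then 1 else α
  have hp : 0 < 1 - α := by linarith
  set D : ℝ := 1 + 1 / (1 - α) with hD
  have hD0 : 0 < D := by positivity
  refine ⟨D + D / κ, by positivity, fun L hL => ?_⟩
  induction L, hL using Nat.le_induction with
  | base =>
    have h1 := tail_le_rpow hα0 hα (k := 1) le_rfl
    have h2 := one_le_chi hα0 (L := 1) le_rfl
    simp only [Nat.cast_one, Real.one_rpow, mul_one] at h1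
    rw [Finset.sum_range_one, zero_add]
    have h3 : 0 < D / κ := by positivity
    nlinarith
  | succ L hL ih =>
    rw [Finset.sum_range_succ]
    have h1 := tail_le_rpow hα0 hα (k := L + 1) (by omega)
    have h2 := le_chi_succ hα0 hα hL
    have h3 : D * ((L + 1 : ℕ) : ℝ) ^ (α - 1) ≤ D / κ * (chi α (L + 1) - chi α L) := by
      calc _ = D / κ * (κ * ((L + 1 : ℕ) : ℝ) ^ (α - 1)) := by field_simp
        _ ≤ _ := by gcongr
    have h4 : 0 ≤ D * (chi α (L + 1) - chi α L) := by
      refine mul_nonneg hD0.le (le_trans ?_ h2)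
      positivity
    linarith

/-! ### Numerical bounds on the exponent -/

lemma coupling_mono {α β : ℝ} (h : α ≤ β) {d : ℕ} (hd : 1 ≤ d) :
    coupling α d ≤ coupling β d :=
  Real.rpow_le_rpow_of_exponent_le (by exact_mod_cast hd) (by linarith)

lemma two_rpow_bounds :
    (65 / 100 : ℝ) ≤ (2 : ℝ) ^ (-(3 / 5) : ℝ) ∧ (2 : ℝ) ^ (-(3 / 5) : ℝ) ≤ 66 / 100 := by
  have h5 : ((2 : ℝ) ^ (-(3 / 5) : ℝ)) ^ 5 = 1 / 8 := by
    rw [← Real.rpow_natCast, ← Real.rpow_mul (by norm_num)]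
    rw [show (-(3 / 5) : ℝ) * ((5 : ℕ) : ℝ) = -(3 : ℕ) by norm_num, Real.rpow_neg (by norm_num),
      Real.rpow_natCast]
    norm_num
  constructor
  · refine le_of_pow_le_pow_left₀ (n := 5) (by norm_num) (by positivity) ?_
    rw [h5]; norm_num
  · refine le_of_pow_le_pow_left₀ (n := 5) (by norm_num) (by norm_num) ?_
    rw [h5]; norm_num

/-- Comparison with an integral up to `1024` shows `ζ(8/5) > 2`. -/
lemma two_lt_tail : 2 < tail (2 / 5) 1 := by
  have hα : (2 / 5 : ℝ) < 1 := by norm_num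
  have h1 := sum_range_add_tail hα 1 1023
  have h2 := tail_nonneg (2 / 5) (1 + 1023)
  rw [Finset.sum_range_succ'] at h1
  simp only [zero_add, coupling_one] at h1
  have h3 : ∀ m, (2 : ℝ) ^ (2 / 5 - 1 : ℝ) - ((m + 2 : ℕ) : ℝ) ^ (2 / 5 - 1 : ℝ) ≤
      (1 - 2 / 5) * ∑ k ∈ Finset.range m, coupling (2 / 5) (k + 1 + 1) := by
    intro m
    induction m with
    | zero => simp
    | succ m ih =>
      rw [Finset.sum_range_succ, mul_add]
      have := le_coupling (α := 2 / 5) (by norm_num) hα (d := m + 2) (by omega)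
      rw [show m + 1 + 1 = m + 2 by ring, show m + 1 + 2 = m + 2 + 1 by ring]
      linarith
  have h4 := h3 1022
  have h5 : ((1022 + 2 : ℕ) : ℝ) ^ (2 / 5 - 1 : ℝ) = 1 / 64 := by
    rw [show ((1022 + 2 : ℕ) : ℝ) = (2 : ℝ) ^ (10 : ℝ) by norm_num,
      ← Real.rpow_mul (by norm_num),
      show (10 : ℝ) * (2 / 5 - 1) = -(6 : ℕ) by norm_num, Real.rpow_neg (by norm_num),
      Real.rpow_natCast]
    norm_num
  have h6 := two_rpow_bounds.1
  rw [show (-(3 / 5) : ℝ) = 2 / 5 - 1 by norm_num] at h6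
  rw [h5] at h4
  linarith

lemma tail_one_mono {α β : ℝ} (h : α ≤ β) (hβ : β < 1) : tail α 1 ≤ tail β 1 :=
  (summable_coupling_add (h.trans_lt hβ) 1).tsum_le_tsum
    (fun _ => coupling_mono h (by omega)) (summable_coupling_add hβ 1)

lemma tail_one_strictMono {α β : ℝ} (h : α < β) (hβ : β < 1) : tail α 1 < tail β 1 := by
  refine Summable.tsum_lt_tsum (i := 1) (fun n => coupling_mono h.le (by omega)) ?_
    (summable_coupling_add (h.trans hβ) 1) (summable_coupling_add hβ 1)
  exact Real.rpow_lt_rpow_of_exponent_lt (by norm_num) (by linarith)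

/-- The couplings at the distances `2e - 1`, `2e` (twice) and `2e + 1` add up to less than `3/2`
times the coupling at distance `e`. The restriction `e ≥ 2` matters: at `e = 1` the first term is
`J(1) = 1`. -/
lemma coupling_neighbours_le {α : ℝ} (hα0 : 0 ≤ α) (hα : α ≤ 2 / 5) {e : ℕ} (he : 2 ≤ e) :
    coupling α (2 * e - 1) + 2 * coupling α (2 * e) + coupling α (2 * e + 1) ≤
      149 / 100 * coupling α e := by
  have he' : (2 : ℝ) ≤ e := by exact_mod_cast he
  set x : ℝ := 2 * e with hx
  have hx4 : (4 : ℝ) ≤ x := by linarith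
  set J := coupling α (2 * e) with hJ
  have hJ0 : 0 ≤ J := coupling_nonneg _ _
  have hJx : J = x ^ (-2 + α) := by simp [hJ, coupling, hx]
  have e1 : J ≤ 33 / 100 * coupling α e := by
    have : J = (2 : ℝ) ^ (-2 + α) * coupling α e := by
      rw [hJx, hx, Real.mul_rpow (by norm_num) (by positivity)]; rfl
    rw [this]
    refine mul_le_mul_of_nonneg_right ?_ (coupling_nonneg _ _)
    have : (2 : ℝ) ^ (-2 + α) ≤ (2 : ℝ) ^ (-(3 / 5) + -1 : ℝ) :=
      Real.rpow_le_rpow_of_exponent_le (by norm_num) (by linarith)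
    rw [Real.rpow_add (by norm_num) (-(3 / 5)), Real.rpow_neg_one] at this
    linarith [two_rpow_bounds.2]
  set A := x / (x - 1) with hA
  set B := x / (x + 1) with hB
  have hA1 : 1 ≤ A := by rw [hA, le_div_iff₀ (by linarith)]; linarith
  have hB0 : 0 < B := by positivity
  have hB1 : B ≤ 1 := by rw [hB, div_le_one (by positivity)]; linarith
  have e2 : coupling α (2 * e - 1) ≤ J * A ^ 2 := by
    have h1 : ((2 * e - 1 : ℕ) : ℝ) = x * A⁻¹ := by
      rw [Nat.cast_sub (by omega), hA]; push_cast; field_simp; rw [hx]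
    rw [coupling, h1, Real.mul_rpow (by positivity) (by positivity), ← hJx]
    refine mul_le_mul_of_nonneg_left ?_ hJ0
    rw [Real.inv_rpow (by positivity), ← Real.rpow_neg (by positivity), ← Real.rpow_natCast]
    exact Real.rpow_le_rpow_of_exponent_le hA1 (by push_cast; linarith)
  have e3 : coupling α (2 * e + 1) ≤ J * (B * ((1 + B) / 2)) := by
    have h1 : ((2 * e + 1 : ℕ) : ℝ) = x * B⁻¹ := by
      rw [hB]; push_cast; field_simp; rw [hx]
    rw [coupling, h1, Real.mul_rpow (by positivity) (by positivity), ← hJx]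
    refine mul_le_mul_of_nonneg_left ?_ hJ0
    rw [Real.inv_rpow (by positivity), ← Real.rpow_neg (by positivity)]
    calc B ^ (-(-2 + α)) ≤ B ^ (1 + 1 / 2 : ℝ) :=
          Real.rpow_le_rpow_of_exponent_ge hB0 hB1 (by linarith)
      _ = B * √B := by rw [Real.rpow_add hB0, Real.rpow_one, Real.sqrt_eq_rpow]
      _ ≤ _ := by
        refine mul_le_mul_of_nonneg_left ?_ hB0.le
        rw [Real.sqrt_le_left (by positivity)]
        nlinarith [sq_nonneg (B - 1)]
  -- With `u = 1 / x ≤ 1 / 4`, both `A` and `B` are bounded by chords in `u`.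
  have e4 : A ^ 2 + B * ((1 + B) / 2) ≤ 5 / 2 := by
    set u := 1 / x with hu
    have hu0 : 0 ≤ u := by positivity
    have hu1 : u ≤ 1 / 4 := by rw [hu, div_le_div_iff₀ (by positivity) (by norm_num)]; linarith
    have hxu : x * u = 1 := by rw [hu]; field_simp
    have hA' : A ≤ 1 + 4 / 3 * u := by
      rw [hA, div_le_iff₀ (by linarith)]; nlinarith
    have hB' : B ≤ 1 - 4 / 5 * u := by
      rw [hB, div_le_iff₀ (by linarith)]; nlinarith
    have hA2 : A ^ 2 ≤ (1 + 4 / 3 * u) ^ 2 := by gcongr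
    have hu2 : 0 ≤ 1 - 4 / 5 * u := by linarith
    have hB2 : B * ((1 + B) / 2) ≤ (1 - 4 / 5 * u) * ((1 + (1 - 4 / 5 * u)) / 2) := by gcongr
    nlinarith
  have e5 : J * A ^ 2 + 2 * J + J * (B * ((1 + B) / 2)) ≤ J * (9 / 2) := by
    have := mul_le_mul_of_nonneg_left e4 hJ0
    linarith
  linarith

/-- The tail, with the terms grouped in pairs. -/
lemma hasSum_tail_split {α : ℝ} (hα : α < 1) (k : ℕ) :
    HasSum (fun n : ℕ => coupling α (2 * n + k) + coupling α (2 * n + 1 + k)) (tail α k) := by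
  have hinj : Function.Injective fun n : ℕ => 2 * n := fun a b h => by simpa using h
  have hinj' : Function.Injective fun n : ℕ => 2 * n + 1 := fun a b h => by simpa using h
  have h1 : Summable fun n : ℕ => coupling α (2 * n + k) :=
    (summable_coupling_add hα k).comp_injective hinj
  have h2 : Summable fun n : ℕ => coupling α (2 * n + 1 + k) :=
    (summable_coupling_add hα k).comp_injective hinj'
  have h3 : tail α k = ∑' n, coupling α (2 * n + k) + ∑' n, coupling α (2 * n + 1 + k) :=
    (tsum_even_add_odd (f := fun n => coupling α (n + k)) h1 h2).symm
  rw [h3]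
  exact h1.hasSum.add h2.hasSum

/-- The numerical fact behind the growth of `W`: the constant on the right is less than `3`. -/
lemma tail_double_le {α : ℝ} (hα0 : 0 ≤ α) (hα : α ≤ 2 / 5) {L : ℕ} (hL : 1 ≤ L) :
    2 * (tail α (2 * L + 1) + tail α (2 * L + 2)) ≤ 149 / 50 * tail α (L + 1) := by
  have hα1 : α < 1 := by linarith
  have hl := ((hasSum_tail_split hα1 (2 * L + 1)).add
    (hasSum_tail_split hα1 (2 * L + 2))).mul_left 2
  have hr := (summable_coupling_add hα1 (L + 1)).hasSum.mul_left (149 / 50)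
  refine hasSum_le (fun n => ?_) hl hr
  have h1 := coupling_neighbours_le hα0 hα (e := n + (L + 1)) (by omega)
  rw [show 2 * (n + (L + 1)) - 1 = 2 * n + (2 * L + 1) by omega,
    show 2 * (n + (L + 1)) + 1 = 2 * n + 1 + (2 * L + 2) by omega] at h1
  have e3 : coupling α (2 * n + 1 + (2 * L + 1)) = coupling α (2 * (n + (L + 1))) := by
    congr 1; omega
  have e4 : coupling α (2 * n + (2 * L + 2)) = coupling α (2 * (n + (L + 1))) := by
    congr 1; omega
  rw [e3, e4]
  linarith

/-! ### The function `W` -/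

/-- `∑_{j=1}^L (t(j) - 2 t(L+j))`, where `t` is the tail of the coupling: one half of `W α L`. -/
noncomputable def halfW (α : ℝ) (L : ℕ) : ℝ :=
  ∑ j ∈ Finset.range L, (tail α (j + 1) - 2 * tail α (L + j + 1))

lemma halfW_eq (α : ℝ) (L : ℕ) :
    halfW α L = 3 * ∑ j ∈ Finset.range L, tail α (j + 1)
      - 2 * ∑ j ∈ Finset.range (2 * L), tail α (j + 1) := by
  rw [halfW, two_mul L, Finset.sum_range_add, Finset.sum_sub_distrib, ← Finset.mul_sum]
  ring

lemma halfW_succ (α : ℝ) (L : ℕ) :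
    halfW α (L + 1) = halfW α L + 3 * tail α (L + 1)
      - 2 * (tail α (2 * L + 1) + tail α (2 * L + 2)) := by
  rw [halfW_eq, halfW_eq, show 2 * (L + 1) = 2 * L + 1 + 1 by ring, Finset.sum_range_succ,
    Finset.sum_range_succ _ (2 * L + 1), Finset.sum_range_succ _ (2 * L)]
  ring

lemma halfW_one {α : ℝ} (hα : α < 1) : halfW α 1 = 2 - tail α 1 := by
  have := tail_eq_add hα 1
  rw [coupling_one] at this
  simp only [halfW, Finset.sum_range_one]
  norm_num at this ⊢
  linarith

/-- Since `ζ(8/5) > 2`, the critical exponent is at most `2/5`. -/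
lemma exponent_le {αs : ℝ} (hαs1 : αs < 1) (hαs : tail αs 1 = 2) : αs ≤ 2 / 5 := by
  by_contra h
  push Not at h
  linarith [tail_one_mono h.le hαs1, two_lt_tail]

lemma exists_chi_le_halfW {α αs : ℝ} (hα0 : 0 ≤ α) (hα : α < αs) (hαs1 : αs < 1)
    (hαs : tail αs 1 = 2) : ∃ ζ : ℝ, 0 < ζ ∧ ∀ L : ℕ, 1 ≤ L → ζ * chi α L ≤ halfW α L := by
  have hα1 : α < 1 := hα.trans hαs1
  have hαs25 : αs ≤ 2 / 5 := exponent_le hαs1 hαs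
  have hw : 0 < halfW α 1 := by
    rw [halfW_one hα1]
    linarith [tail_one_strictMono hα hαs1]
  refine ⟨min (halfW α 1 / 4) (1 / 400), by positivity, fun L hL => ?_⟩
  set ζ := min (halfW α 1 / 4) (1 / 400)
  have hζ0 : 0 < ζ := by positivity
  have hζ1 : ζ ≤ halfW α 1 / 4 := min_le_left _ _
  have hζ2 : ζ ≤ 1 / 400 := min_le_right _ _
  induction L, hL using Nat.le_induction with
  | base => nlinarith [chi_one_le α]
  | succ L hL ih =>
    rw [halfW_succ]
    have h1 := tail_double_le hα0 (hα.le.trans hαs25) hL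
    have h2 := rpow_le_tail hα0 hα1 (k := L + 1) (by omega)
    have h3 := mul_le_mul_of_nonneg_left (chi_succ_le hα0 hα1 hL) hζ0.le
    have h4 : (0 : ℝ) ≤ ((L + 1 : ℕ) : ℝ) ^ (α - 1) := by positivity
    have h5 := mul_le_mul_of_nonneg_right hζ2 h4
    linarith

/-! ### Sums of the coupling over half-lines -/

lemma hasSum_right {α : ℝ} (hα : α < 1) {x a : ℤ} {k : ℕ} (hk : x + k = a) :
    HasSum (fun y : ℤ => if a ≤ y then coupling α (x - y).natAbs else 0) (tail α k) := by
  have hinj : Function.Injective fun n : ℕ => a + (n : ℤ) := fun m n h => by simpa using h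
  refine (hinj.hasSum_iff fun y hy => if_neg fun h => hy ⟨(y - a).toNat, ?_⟩).1 ?_
  · simp only; omega
  · refine ((summable_coupling_add hα k).hasSum.congr_fun fun n => ?_)
    simp only [Function.comp]
    rw [if_pos (by omega)]
    congr 1; omega

lemma hasSum_left {α : ℝ} (hα : α < 1) {x b : ℤ} {k : ℕ} (hk : b + k = x) :
    HasSum (fun y : ℤ => if y ≤ b then coupling α (x - y).natAbs else 0) (tail α k) := by
  have hinj : Function.Injective fun n : ℕ => b - (n : ℤ) := fun m n h => by simpa using h
  refine (hinj.hasSum_iff fun y hy => if_neg fun h => hy ⟨(b - y).toNat, ?_⟩).1 ?_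
  · simp only; omega
  · refine ((summable_coupling_add hα k).hasSum.congr_fun fun n => ?_)
    simp only [Function.comp]
    rw [if_pos (by omega)]
    congr 1; omega

lemma hasSum_coupling_int {α : ℝ} (hα : α < 1) (x : ℤ) :
    HasSum (fun y : ℤ => coupling α (x - y).natAbs) (tail α 0 + tail α 1) := by
  have h1 := hasSum_right hα (x := x) (a := x) (k := 0) (by simp)
  have h2 := hasSum_left hα (x := x) (b := x - 1) (k := 1) (by simp)
  refine (h1.add h2).congr_fun fun y => ?_
  split_ifs <;> first | omega | simp

lemma summable_coupling_int {α : ℝ} (hα : α < 1) (x : ℤ) :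
    Summable fun y : ℤ => coupling α (x - y).natAbs := (hasSum_coupling_int hα x).summable

/-- The coupling between `x` in `(l, r]` and `y`, counted positively for `y` in the two adjacent
intervals of the same length and negatively for `y` further away. -/
noncomputable def signedCoupling (α : ℝ) (l r x y : ℤ) : ℝ :=
  if l < y ∧ y ≤ r then 0
  else if 2 * l - r < y ∧ y ≤ 2 * r - l then coupling α (x - y).natAbs
  else -coupling α (x - y).natAbs

lemma hasSum_signedCoupling {α : ℝ} (hα : α < 1) {l r x : ℤ} {i j L : ℕ} (hL : l + L = r)
    (hi : l + i + 1 = x) (hj : x + j = r) :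
    HasSum (signedCoupling α l r x)
      ((tail α (j + 1) - 2 * tail α (L + j + 1)) + (tail α (i + 1) - 2 * tail α (L + i + 1))) := by
  have h1 := hasSum_right hα (x := x) (a := r + 1) (k := j + 1) (by push_cast; omega)
  have h2 := hasSum_right hα (x := x) (a := r + L + 1) (k := L + j + 1) (by push_cast; omega)
  have h3 := hasSum_left hα (x := x) (b := l) (k := i + 1) (by push_cast; omega)
  have h4 := hasSum_left hα (x := x) (b := l - L) (k := L + i + 1) (by push_cast; omega)
  refine ((h1.sub (h2.mul_left 2)).add (h3.sub (h4.mul_left 2))).congr_fun fun y => ?_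
  simp only [signedCoupling]
  split_ifs <;> first | omega | ring

/-- The sum over an interval of a function of the distances to its two ends; every distance occurs
once for each end. -/
lemma sum_Ioc_add_reflect (f : ℕ → ℝ) {l r : ℤ} {L : ℕ} (hL : l + L = r) :
    ∑ x ∈ Finset.Ioc l r, (f (r - x).toNat + f (x - l - 1).toNat) =
      2 * ∑ i ∈ Finset.range L, f i := by
  have e : ∑ x ∈ Finset.Ioc l r, (f (r - x).toNat + f (x - l - 1).toNat) =
      ∑ i ∈ Finset.range L, (f (L - 1 - i) + f i) := by
    refine Finset.sum_bij' (fun x _ => (x - l - 1).toNat) (fun i _ => l + i + 1)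
      ?_ ?_ ?_ ?_ ?_ <;> simp only [Finset.mem_Ioc, Finset.mem_range]
    · intro x hx; omega
    · intro i hi; omega
    · intro x hx; omega
    · intro i hi; omega
    · intro x hx
      congr 2; omega
  rw [e, Finset.sum_add_distrib, Finset.sum_range_reflect f L]
  ring

lemma sum_signedCoupling {α : ℝ} (hα : α < 1) {l r : ℤ} {L : ℕ} (hL : l + L = r) :
    ∑ x ∈ Finset.Ioc l r, ∑' y, signedCoupling α l r x y = 2 * halfW α L := by
  rw [halfW, ← sum_Ioc_add_reflect (fun j => tail α (j + 1) - 2 * tail α (L + j + 1)) hL]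
  refine Finset.sum_congr rfl fun x hx => ?_
  have := Finset.mem_Ioc.1 hx
  exact (hasSum_signedCoupling hα hL (by omega) (by omega)).tsum_eq

lemma W_eq {α : ℝ} (hα : α < 1) (L : ℕ) : W α L = 2 * halfW α L := by
  rw [← sum_signedCoupling hα (l := 0) (r := L) (by simp), W]
  refine Finset.sum_congr (by ext x; simp only [Finset.mem_Icc, Finset.mem_Ioc]; omega)
    fun x _ => ?_
  rw [tsum_subtype (Set.Ici (2 * (L : ℤ) + 1) ∪ Set.Iic (-(L : ℤ)))
    (fun y => coupling α (x - y).natAbs),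
    sum_eq_tsum_indicator, ← Summable.tsum_sub ((summable_coupling_int hα x).indicator _)
      ((summable_coupling_int hα x).indicator _)]
  refine tsum_congr fun y => ?_
  simp only [Set.indicator, signedCoupling, Finset.coe_union, Finset.coe_Icc, Set.mem_union,
    Set.mem_Icc, Set.mem_Ici, Set.mem_Iic]
  split_ifs <;> first | omega | ring

/-! ### Energies as sums over pairs of sites -/

lemma coupling_symm (α : ℝ) (x y : ℤ) : coupling α (x - y).natAbs = coupling α (y - x).natAbs := by
  congr 1; omega

/-- The contribution of the pair `p` to twice the energy of the spin configuration `σ`. -/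
noncomputable def cut (α : ℝ) (σ : ℤ → ℤˣ) (p : ℤ × ℤ) : ℝ :=
  if σ p.1 ≠ σ p.2 then coupling α (p.1 - p.2).natAbs else 0

lemma cut_nonneg (α : ℝ) (σ : ℤ → ℤˣ) (p : ℤ × ℤ) : 0 ≤ cut α σ p := by
  unfold cut
  split_ifs
  · exact coupling_nonneg _ _
  · exact le_rfl

/-- Summation over the pairs whose first component lies in a finite set can be carried out row by
row. -/
lemma hasSum_strip {A : Finset ℤ} {g : ℤ → ℤ → ℝ} {s : ℤ → ℝ}
    (h : ∀ x ∈ A, HasSum (g x) (s x)) :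
    HasSum (fun p : ℤ × ℤ => if p.1 ∈ A then g p.1 p.2 else 0) (∑ x ∈ A, s x) := by
  have h1 : ∀ x ∈ A, HasSum (fun p : ℤ × ℤ => if p.1 = x then g x p.2 else 0) (s x) := by
    intro x hx
    have hinj : Function.Injective fun y : ℤ => (x, y) := fun a b h => by simpa using h
    refine (hinj.hasSum_iff fun p hp => if_neg fun hpx => hp ⟨p.2, ?_⟩).1 ?_
    · exact Prod.ext hpx.symm rfl
    · exact (h x hx).congr_fun fun y => by simp
  refine (hasSum_sum h1).congr_fun fun p => ?_
  by_cases hp : p.1 ∈ A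
  · rw [if_pos hp, Finset.sum_eq_single_of_mem p.1 hp fun x _ hx => if_neg hx.symm, if_pos rfl]
  · rw [if_neg hp]
    exact (Finset.sum_eq_zero fun x hx => if_neg fun (h : p.1 = x) => hp (h ▸ hx)).symm

lemma hasSum_strip_swap {A : Finset ℤ} {g : ℤ → ℤ → ℝ} {s : ℤ → ℝ}
    (h : ∀ x ∈ A, HasSum (g x) (s x)) :
    HasSum (fun p : ℤ × ℤ => if p.2 ∈ A then g p.2 p.1 else 0) (∑ x ∈ A, s x) := by
  have h1 := hasSum_strip h
  rw [← (Equiv.prodComm ℤ ℤ).hasSum_iff] at h1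
  exact h1.congr_fun fun p => rfl

/-- A function on pairs of sites that is dominated by the coupling and vanishes unless one of the
sites lies in a fixed finite set is summable. -/
lemma summable_coupling_of_mem {α : ℝ} (hα : α < 1) {A : Finset ℤ} {f : ℤ × ℤ → ℝ}
    (hf0 : ∀ p, 0 ≤ f p) (hf1 : ∀ p, f p ≤ coupling α (p.1 - p.2).natAbs)
    (hfA : ∀ p : ℤ × ℤ, p.1 ∉ A → p.2 ∉ A → f p = 0) : Summable f := by
  have h1 := (hasSum_strip (A := A) fun x _ => (summable_coupling_int hα x).hasSum).summable
  have h2 := (hasSum_strip_swap (A := A) fun x _ => (summable_coupling_int hα x).hasSum).summable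
  refine Summable.of_nonneg_of_le hf0 (fun p => ?_) (h1.add h2)
  have h0 := coupling_nonneg α (p.1 - p.2).natAbs
  have h3 := hf1 p
  have h4 := coupling_symm α p.1 p.2
  by_cases hp1 : p.1 ∈ A <;> by_cases hp2 : p.2 ∈ A
  · simp only [hp1, hp2, if_true]; linarith
  · simp only [hp1, hp2, if_true, if_false]; linarith
  · simp only [hp1, hp2, if_true, if_false]; linarith
  · simp [hp1, hp2, hfA p hp1 hp2]

lemma spin_eq_one_of_notMem {τ : Finset Triangle} {x : ℤ} (hx : x ∉ Contour.base τ) :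
    spin τ x = 1 :=
  Finset.prod_eq_one fun _ hT => if_neg fun h => hx (Finset.mem_biUnion.2 ⟨_, hT, h⟩)

lemma summable_cut {α : ℝ} (hα : α < 1) (τ : Finset Triangle) : Summable (cut α (spin τ)) := by
  refine summable_coupling_of_mem hα (A := Contour.base τ) (cut_nonneg _ _) (fun p => ?_)
    fun p h1 h2 => ?_
  · unfold cut
    split_ifs
    · exact le_rfl
    · exact coupling_nonneg _ _
  · simp [cut, spin_eq_one_of_notMem h1, spin_eq_one_of_notMem h2]

lemma energy_eq (α : ℝ) (C : Finset Contour) :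
    energy α C = 1 / 2 * ∑' p, cut α (spin (C.biUnion id)) p := by
  unfold energy cut
  congr 1
  refine tsum_congr fun p => if_congr ⟨fun h => h.2, fun h => ⟨fun he => h (by rw [he]), h⟩⟩ rfl rfl

lemma Triangle.left_add_mass (T : Triangle) : T.left + (T.mass : ℤ) = T.right := by
  have := T.left_lt_right
  simp only [Triangle.mass, Triangle.base, Int.card_Ioc]
  omega

lemma Triangle.one_le_mass (T : Triangle) : 1 ≤ T.mass := by
  have := T.left_lt_right
  have := T.left_add_mass
  omega

/-! ### Removing the smallest triangle -/

/-- If `σ` arises from `σ'` by flipping the base of `T`, and `σ'` is constant on this base and on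
the two adjacent intervals of the same length, then the flip costs at least `W α T.mass`. -/
lemma W_le_of_flip {α : ℝ} (hα : α < 1) {T : Triangle} {σ σ' : ℤ → ℤˣ}
    (hflip : ∀ x, σ x = (if x ∈ T.base then -1 else 1) * σ' x)
    (hconst : ∀ x y, 2 * T.left - T.right < x → x ≤ y → y ≤ 2 * T.right - T.left → σ' x = σ' y)
    (hs : Summable (cut α σ)) (hs' : Summable (cut α σ')) :
    W α T.mass ≤ 1 / 2 * ∑' p, cut α σ p - 1 / 2 * ∑' p, cut α σ' p := by
  have hlr := T.left_lt_right
  have hL := T.left_add_mass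
  have hrow : ∀ x ∈ T.base, HasSum (signedCoupling α T.left T.right x)
      (∑' y, signedCoupling α T.left T.right x y) := fun x hx => by
    have := Finset.mem_Ioc.1 hx
    exact (hasSum_signedCoupling hα hL (i := (x - T.left - 1).toNat) (j := (T.right - x).toNat)
      (by omega) (by omega)).summable.hasSum
  have hsum := (hasSum_strip hrow).add (hasSum_strip_swap hrow)
  have htot : ∑ x ∈ T.base, ∑' y, signedCoupling α T.left T.right x y = W α T.mass := by
    rw [W_eq hα, Triangle.base, sum_signedCoupling hα hL]
  rw [htot] at hsum
  have hconst' : ∀ x y, 2 * T.left - T.right < x → x ≤ 2 * T.right - T.left →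
      2 * T.left - T.right < y → y ≤ 2 * T.right - T.left → σ' x = σ' y := by
    intro x y hx hx' hy hy'
    rcases le_total x y with h | h
    · exact hconst x y hx h hy'
    · exact (hconst y x hy h hx').symm
  have key : ∀ x y, x ∈ T.base → y ∉ T.base →
      signedCoupling α T.left T.right x y ≤ cut α σ (x, y) - cut α σ' (x, y) := by
    intro x y hx hy
    have hJ := coupling_nonneg α (x - y).natAbs
    have hσx : σ x = -σ' x := by simp [hflip x, hx]
    have hσy : σ y = σ' y := by simp [hflip y, hy]
    simp only [Triangle.base, Finset.mem_Ioc] at hx hy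
    simp only [signedCoupling, if_neg hy]
    by_cases hnear : 2 * T.left - T.right < y ∧ y ≤ 2 * T.right - T.left
    · have h1 : σ' x = σ' y := hconst' x y (by omega) (by omega) hnear.1 hnear.2
      have h2 : -σ' y ≠ σ' y := (units_ne_neg_self _).symm
      simp [cut, hσx, hσy, h1, h2, hnear]
    · rw [if_neg hnear]
      simp only [cut]
      split_ifs <;> linarith
  have hswap : ∀ (ρ : ℤ → ℤˣ) x y, cut α ρ (x, y) = cut α ρ (y, x) := by
    intro ρ x y
    simp only [cut, coupling_symm α x y, ne_comm]
  have hle := hasSum_le (fun p : ℤ × ℤ => ?_) hsum (hs.hasSum.sub hs'.hasSum)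
  · linarith
  · obtain ⟨x, y⟩ := p
    by_cases hx : x ∈ T.base <;> by_cases hy : y ∈ T.base
    · have h1 : signedCoupling α T.left T.right x y = 0 := if_pos (Finset.mem_Ioc.1 hy)
      have h2 : signedCoupling α T.left T.right y x = 0 := if_pos (Finset.mem_Ioc.1 hx)
      have h3 : cut α σ (x, y) = cut α σ' (x, y) := by
        simp only [cut, hflip x, hflip y, hx, hy, if_true, ne_eq, mul_right_inj]
      simp [hx, hy, h1, h2, h3]
    · simpa [hx, hy] using key x y hx hy
    · have := key y x hy hx
      rw [hswap σ y x, hswap σ' y x] at this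
      simpa [hx, hy] using this
    · have h3 : cut α σ (x, y) = cut α σ' (x, y) := by
        simp only [cut, hflip x, hflip y, hx, hy, if_false, one_mul]
      simp [hx, hy, h3]

/-- The spins of a family of triangles are constant along stretches without roots. -/
lemma Grows.spin_eq {r : ℤ → ℝ} {F : Finset ℤ} {τ : Finset Triangle} (h : Grows r F τ) {x y : ℤ}
    (hxy : x ≤ y) (hF : ∀ k ∈ F, x ≤ k → y ≤ k) : spin τ x = spin τ y := by
  refine Finset.prod_congr rfl fun T hT => ?_
  have h1 := hF _ (h.roots_mem T hT).1
  have h2 := hF _ (h.roots_mem T hT).2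
  have h3 := T.left_lt_right
  simp only [Triangle.base, Finset.mem_Ioc]
  exact if_congr (by omega) rfl rfl

/-- A subfamily of a family of triangles grown from lines grows from its own roots. -/
lemma Grows.subset {r : ℤ → ℝ} {F : Finset ℤ} {τ : Finset Triangle} (h : Grows r F τ) :
    ∀ S ⊆ τ, ∃ F' ⊆ F, Grows r F' S := by
  induction h with
  | nil =>
    intro S hS
    rw [Finset.subset_empty.1 hS]
    exact ⟨∅, subset_rfl, Grows.nil⟩
  | step F T τ hl hr hmin h ih =>
    intro S hS
    by_cases hT : T ∈ S
    · obtain ⟨F', hF', hG⟩ := ih (S.erase T) fun T' hT' => by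
        have h1 := Finset.mem_erase.1 hT'
        exact (Finset.mem_insert.1 (hS h1.2)).resolve_left h1.1
      have hl' : T.left ∉ F' := fun h => by simpa using hF' h
      have hr' : T.right ∉ F' := fun h => by simpa using hF' h
      have hsub : insert T.left (insert T.right F') ⊆ F := by
        refine Finset.insert_subset hl (Finset.insert_subset hr (hF'.trans ?_))
        exact (Finset.erase_subset _ _).trans (Finset.erase_subset _ _)
      refine ⟨_, hsub, ?_⟩
      rw [← Finset.insert_erase hT]
      refine Grows.step _ T _ (by simp) (by simp)
        (fun i hi j hj hij => hmin i (hsub hi) j (hsub hj) hij) ?_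
      have hne := T.left_lt_right.ne
      rwa [Finset.erase_insert (by simp [hl', hne]), Finset.erase_insert hr']
    · obtain ⟨F', hF', hG⟩ := ih S fun T' hT' =>
        (Finset.mem_insert.1 (hS hT')).resolve_left fun h => hT (h ▸ hT')
      exact ⟨F', hF'.trans ((Finset.erase_subset _ _).trans (Finset.erase_subset _ _)), hG⟩

/-- The energy of a family of triangles is at least the sum of the `W α |T|`: remove the
triangles one by one, always the smallest one. -/
lemma Grows.sum_W_le {α : ℝ} (hα : α < 1) {r : ℤ → ℝ} (hr : IsRootChoice r) {F : Finset ℤ}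
    {τ : Finset Triangle} (h : Grows r F τ) :
    ∑ T ∈ τ, W α T.mass ≤ 1 / 2 * ∑' p, cut α (spin τ) p := by
  induction h with
  | nil => simp [cut, spin]
  | step F T τ hl hr' hmin h ih =>
    have hT : T ∉ τ := fun hT => by simpa using (h.roots_mem T hT).1
    rw [Finset.sum_insert hT]
    have hclose : ∀ i : ℤ, (i : ℝ) + 1 / 2 - 1 / 100 ≤ r i ∧ r i ≤ (i : ℝ) + 1 / 2 + 1 / 100 :=
      fun i => hr.1 i
    have hlr := T.left_lt_right
    -- The points `r i` move distances by at most `1 / 50`, so the minimality of `T` passes to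
    -- the integer distances between flips.
    have hgap : ∀ i ∈ F, ∀ j ∈ F, i < j → T.right - T.left ≤ j - i := by
      intro i hi j hj hij
      have h1 := hmin i hi j hj hij.ne
      by_contra hcon
      have h2 : j - i + 1 ≤ T.right - T.left := by omega
      have h3 : (j : ℝ) - i + 1 ≤ T.right - T.left := by exact_mod_cast h2
      have h4 : (i : ℝ) + 1 ≤ j := by exact_mod_cast hij
      have hi' := hclose i
      have hj' := hclose j
      have hl' := hclose T.left
      have hr' := hclose T.right
      rw [abs_sub_comm, abs_sub_comm (r i), abs_of_nonneg (by linarith),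
        abs_of_nonneg (by linarith)] at h1
      linarith
    have := W_le_of_flip hα (T := T) (σ := spin (insert T τ)) (σ' := spin τ)
      (fun x => Finset.prod_insert hT) (fun x y hx hxy hy => h.spin_eq hxy fun k hk hxk => ?_)
      (summable_cut hα _) (summable_cut hα _)
    · linarith
    · simp only [Finset.mem_erase] at hk
      obtain ⟨hkr, hkl, hkF⟩ := hk
      rcases lt_or_gt_of_ne hkl with h1 | h1
      · have := hgap k hkF _ hl h1; omega
      · rcases lt_or_gt_of_ne hkr with h2 | h2
        · have := hgap _ hl k hkF h1; omega
        · have := hgap _ hr' k hkF h2; omega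

/-! ### The interaction of one triangle with its complement -/

lemma spin_singleton_ne_iff {T : Triangle} {x y : ℤ} :
    spin {T} x ≠ spin {T} y ↔ ¬(x ∈ T.base ↔ y ∈ T.base) := by
  simp only [spin, Finset.prod_singleton]
  split_ifs with h1 h2 h2 <;> simp [h1, h2]

lemma exists_of_spin_ne {τ : Finset Triangle} {x y : ℤ} (h : spin τ x ≠ spin τ y) :
    ∃ T ∈ τ, spin {T} x ≠ spin {T} y := by
  by_contra hcon
  push Not at hcon
  exact h (Finset.prod_congr rfl fun T hT => by simpa [spin] using hcon T hT)

/-- The interaction of the site `y` with the sites on the other side of the base of `T`. -/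
noncomputable def potential (α : ℝ) (T : Triangle) (y : ℤ) : ℝ :=
  ∑' x, cut α (spin {T}) (y, x)

lemma summable_cut_row {α : ℝ} (hα : α < 1) (τ : Finset Triangle) (y : ℤ) :
    Summable fun x => cut α (spin τ) (y, x) :=
  (summable_cut hα τ).comp_injective fun a b h => by simpa using h

lemma potential_nonneg (α : ℝ) (T : Triangle) (y : ℤ) : 0 ≤ potential α T y :=
  tsum_nonneg fun _ => cut_nonneg _ _ _

/-- Twice the energy of a single triangle. -/
lemma hasSum_cut_singleton {α : ℝ} (hα : α < 1) (T : Triangle) :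
    HasSum (cut α (spin {T})) (4 * ∑ j ∈ Finset.range T.mass, tail α (j + 1)) := by
  have hrow : ∀ x ∈ T.base, HasSum
      (fun y => if y ∈ T.base then 0 else coupling α (x - y).natAbs)
      (tail α ((T.right - x).toNat + 1) + tail α ((x - T.left - 1).toNat + 1)) := fun x hx => by
    have hx := Finset.mem_Ioc.1 hx
    have hlr := T.left_lt_right
    have h1 := hasSum_right hα (x := x) (a := T.right + 1) (k := (T.right - x).toNat + 1)
      (by push_cast; omega)
    have h2 := hasSum_left hα (x := x) (b := T.left) (k := (x - T.left - 1).toNat + 1)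
      (by push_cast; omega)
    refine (h1.add h2).congr_fun fun y => ?_
    simp only [Triangle.base, Finset.mem_Ioc]
    split_ifs <;> first | omega | ring
  have hsum := (hasSum_strip hrow).add (hasSum_strip_swap hrow)
  have htot := sum_Ioc_add_reflect (fun j => tail α (j + 1)) T.left_add_mass
  rw [Triangle.base, htot] at hsum
  convert hsum.congr_fun (g := cut α (spin {T})) fun p => ?_ using 1
  · ring
  · simp only [cut, spin_singleton_ne_iff, Triangle.base]
    have h := coupling_symm α p.1 p.2
    split_ifs <;> first | (exfalso; tauto) | linarith

lemma hasSum_potential {α : ℝ} (hα : α < 1) (T : Triangle) :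
    HasSum (potential α T) (4 * ∑ j ∈ Finset.range T.mass, tail α (j + 1)) :=
  (hasSum_cut_singleton hα T).prod_fiberwise fun y => (summable_cut_row hα {T} y).hasSum

/-- If `x` lies in the base of `T` and is separated from `y` by a triangle `T'` whose roots are
far from those of `T`, then `x` and `y` are far apart. -/
lemma lt_natAbs_sub {T T' : Triangle} {x y : ℤ} {D : ℕ} (hm : T.mass ≤ D) (hD : D < T.dist T')
    (hx : x ∈ T.base) (hxy : spin {T'} x ≠ spin {T'} y) : D < (x - y).natAbs := by
  rw [spin_singleton_ne_iff] at hxy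
  have h1 := T.left_add_mass
  have h2 := T'.left_lt_right
  simp only [Triangle.base, Finset.mem_Ioc] at hx hxy
  simp only [Triangle.dist, lt_min_iff] at hD
  obtain ⟨⟨d1, d2⟩, d3, d4⟩ := hD
  by_cases c1 : T'.left < x <;> by_cases c2 : x ≤ T'.right <;> by_cases c3 : T'.left < y <;>
    by_cases c4 : y ≤ T'.right <;> simp only [c1, c2, c3, c4] at hxy <;>
    first | omega | simp at hxy

/-- The potential of `T` at a site away from the roots of `T` is controlled by its average over an
interval around this site. -/
lemma potential_le_sum {α : ℝ} (hα0 : 0 ≤ α) (hα : α < 1) {T : Triangle} {y : ℤ} {R : ℕ}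
    (hR : ∀ x, spin {T} y ≠ spin {T} x → R < (y - x).natAbs) :
    (2 * R + 1) * potential α T y ≤
      4 * ∑ z ∈ Finset.Icc (y - R) (y + R), potential α T z := by
  have key : ∀ z ∈ Finset.Icc (y - R : ℤ) (y + R), potential α T y ≤ 4 * potential α T z := by
    intro z hz
    have hz := Finset.mem_Icc.1 hz
    have hyz : spin {T} y = spin {T} z := by
      by_contra h
      have := hR z h
      omega
    rw [potential, potential, ← tsum_mul_left]
    refine (summable_cut_row hα _ y).tsum_le_tsum (fun x => ?_)
      ((summable_cut_row hα _ z).mul_left 4)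
    simp only [cut, ← hyz]
    split_ifs with h
    · have h1 := hR x h
      exact coupling_le_four_mul hα0 hα (by omega) (by omega)
    · simp
  have h := Finset.sum_le_sum key
  rw [Finset.sum_const, Int.card_Icc, ← Finset.mul_sum, nsmul_eq_mul,
    show (y + R + 1 - (y - R)).toNat = 2 * R + 1 by omega] at h
  exact_mod_cast h

/-! ### The interaction of one triangle with many small contours -/

lemma Triangle.mass_le {Γ : Contour} {T : Triangle} (hT : T ∈ Γ) : T.mass ≤ Γ.mass :=
  Finset.single_le_sum (f := Triangle.mass) (fun _ _ => Nat.zero_le _) hT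

lemma Contour.one_le_mass {Γ : Contour} (hΓ : Γ.Nonempty) : 1 ≤ Γ.mass := by
  obtain ⟨T, hT⟩ := hΓ
  exact T.one_le_mass.trans (Triangle.mass_le hT)

lemma Contour.card_base_le (Γ : Contour) : (Contour.base Γ).card ≤ Γ.mass :=
  Finset.card_biUnion_le

/-- Among well separated contours of the same mass `m`, at most one comes within `k m³` of a given
site. -/
lemma eq_of_near {k : ℕ} (hk : 1 ≤ k) {Γ Γ' : Contour} (hm : Γ.mass = Γ'.mass)
    (hsep : Γ ≠ Γ' → ∀ T ∈ Γ, ∀ T' ∈ Γ', 4 * (k * Γ.mass ^ 3) < T.dist T') {y y' z : ℤ}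
    (hy : y ∈ Contour.base Γ) (hy' : y' ∈ Contour.base Γ')
    (hz : z ∈ Finset.Icc (y - (k * Γ.mass ^ 3 : ℕ)) (y + (k * Γ.mass ^ 3 : ℕ)))
    (hz' : z ∈ Finset.Icc (y' - (k * Γ'.mass ^ 3 : ℕ)) (y' + (k * Γ'.mass ^ 3 : ℕ))) :
    Γ = Γ' := by
  by_contra hne
  obtain ⟨T, hT, hyT⟩ := Finset.mem_biUnion.1 hy
  obtain ⟨T', hT', hyT'⟩ := Finset.mem_biUnion.1 hy'
  have h := hsep hne T hT T' hT'
  have h1 := Triangle.mass_le hT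
  have h2 := Triangle.mass_le hT'
  have h3 := T.left_add_mass
  have h4 := T'.left_add_mass
  have h5 : Γ.mass ≤ k * Γ.mass ^ 3 :=
    (Nat.le_self_pow (by norm_num) _).trans (Nat.le_mul_of_pos_left _ hk)
  rw [← hm] at h2 hz'
  simp only [Triangle.base, Finset.mem_Ioc] at hyT hyT'
  simp only [Triangle.dist, lt_min_iff] at h
  generalize k * Γ.mass ^ 3 = R at *
  simp only [Finset.mem_Icc] at hz hz'
  omega

/-- The total interaction of the triangle `T` with the sites in the bases of well separated
contours is of order `1 / k` times the interaction of the base of `T` with its complement: after averaging the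
potential around every site, a given site is used by at most one contour of each mass `m`, with a
total weight of order `m / (k m³)`. -/
lemma sum_potential_le {α : ℝ} (hα0 : 0 ≤ α) (hα : α < 1) {T : Triangle} {k : ℕ} (hk : 1 ≤ k)
    {S : Finset Contour} (hne : ∀ Γ ∈ S, Γ.Nonempty)
    (hT : ∀ Γ ∈ S, ∀ T' ∈ Γ, k * Γ.mass ^ 3 < T'.dist T)
    (hS : ∀ Γ ∈ S, ∀ Γ' ∈ S, Γ.mass = Γ'.mass → Γ ≠ Γ' →
      ∀ T ∈ Γ, ∀ T' ∈ Γ', 4 * (k * Γ.mass ^ 3) < T.dist T') :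
    ∑ Γ ∈ S, ∑ y ∈ Contour.base Γ, potential α T y ≤
      2 / k * (∑' m : ℕ, 1 / (m : ℝ) ^ 2) *
        (4 * ∑ j ∈ Finset.range T.mass, tail α (j + 1)) := by
  classical
  have hk' : (1 : ℝ) ≤ k := by exact_mod_cast hk
  set I : Contour → ℤ → Finset ℤ := fun Γ y =>
    Finset.Icc (y - (k * Γ.mass ^ 3 : ℕ)) (y + (k * Γ.mass ^ 3 : ℕ)) with hI
  set Z : Finset ℤ := S.biUnion fun Γ => (Contour.base Γ).biUnion (I Γ) with hZ
  set f := potential α T with hf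
  have hf0 : ∀ z, 0 ≤ f z := potential_nonneg α T
  -- Replace the potential at each site by its average over the interval `I Γ y`.
  have step1 : ∀ Γ ∈ S, ∀ y ∈ Contour.base Γ,
      f y ≤ ∑ z ∈ Z, if z ∈ I Γ y then 2 / (k * (Γ.mass : ℝ) ^ 3) * f z else 0 := by
    intro Γ hΓ y hy
    have hm1 : (1 : ℝ) ≤ Γ.mass := by exact_mod_cast Contour.one_le_mass (hne Γ hΓ)
    obtain ⟨T', hT', hyT'⟩ := Finset.mem_biUnion.1 hy
    have h1 : Γ.mass ≤ k * Γ.mass ^ 3 :=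
      (Nat.le_self_pow (by norm_num) _).trans (Nat.le_mul_of_pos_left _ hk)
    have h2 := potential_le_sum hα0 hα (T := T) (y := y) (R := k * Γ.mass ^ 3) fun x hx =>
      lt_natAbs_sub ((Triangle.mass_le hT').trans h1) (hT Γ hΓ T' hT') hyT' hx
    have hsub : I Γ y ⊆ Z := (Finset.subset_biUnion_of_mem (I Γ) hy).trans
      (Finset.subset_biUnion_of_mem (fun Γ => (Contour.base Γ).biUnion (I Γ)) hΓ)
    rw [← Finset.sum_filter, Finset.filter_mem_eq_inter, Finset.inter_eq_right.2 hsub,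
      ← Finset.mul_sum]
    push_cast at h2
    have hR : (0 : ℝ) < k * (Γ.mass : ℝ) ^ 3 := by positivity
    have h3 : (2 * (k * (Γ.mass : ℝ) ^ 3)) * f y ≤ 4 * ∑ z ∈ I Γ y, f z := by
      refine le_trans ?_ h2
      nlinarith [hf0 y]
    rw [div_mul_eq_mul_div, le_div_iff₀ hR]
    linarith
  -- Every site `z` lies in the intervals of at most one contour of each mass.
  have step2 : ∀ z, ∑ Γ ∈ S, ∑ y ∈ Contour.base Γ,
      (if z ∈ I Γ y then (2 : ℝ) / (k * (Γ.mass : ℝ) ^ 3) else 0) ≤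
      2 / k * ∑' m : ℕ, 1 / (m : ℝ) ^ 2 := by
    intro z
    set S' := S.filter fun Γ => ∃ y ∈ Contour.base Γ, z ∈ I Γ y with hS'
    have h1 : ∀ Γ ∈ S, ∑ y ∈ Contour.base Γ,
        (if z ∈ I Γ y then (2 : ℝ) / (k * (Γ.mass : ℝ) ^ 3) else 0) ≤
        if ∃ y ∈ Contour.base Γ, z ∈ I Γ y then 2 / k * (1 / (Γ.mass : ℝ) ^ 2) else 0 := by
      intro Γ hΓ
      have hm1 : (1 : ℝ) ≤ Γ.mass := by exact_mod_cast Contour.one_le_mass (hne Γ hΓ)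
      split_ifs with h
      · have hcard : ((Contour.base Γ).card : ℝ) ≤ Γ.mass := by
          exact_mod_cast Contour.card_base_le Γ
        calc _ ≤ ∑ y ∈ Contour.base Γ, 2 / (k * (Γ.mass : ℝ) ^ 3) := by
              refine Finset.sum_le_sum fun y _ => ?_
              split_ifs
              · exact le_rfl
              · positivity
          _ = (Contour.base Γ).card * (2 / (k * (Γ.mass : ℝ) ^ 3)) := by
              rw [Finset.sum_const, nsmul_eq_mul]
          _ ≤ Γ.mass * (2 / (k * (Γ.mass : ℝ) ^ 3)) := by gcongr
          _ = _ := by field_simp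
      · push Not at h
        exact (Finset.sum_eq_zero fun y hy => if_neg (h y hy)).le
    refine (Finset.sum_le_sum h1).trans ?_
    rw [← Finset.sum_filter, ← Finset.mul_sum]
    refine mul_le_mul_of_nonneg_left ?_ (by positivity)
    have hinj : Set.InjOn Contour.mass (S' : Set Contour) := by
      intro Γ hΓ Γ' hΓ' hm
      obtain ⟨h1, y, hy, hz⟩ := Finset.mem_filter.1 hΓ
      obtain ⟨h1', y', hy', hz'⟩ := Finset.mem_filter.1 hΓ'
      exact eq_of_near hk hm (hS Γ h1 Γ' h1' hm) hy hy' hz hz'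
    rw [← Finset.sum_image (g := Contour.mass) (f := fun m : ℕ => 1 / (m : ℝ) ^ 2) hinj]
    exact (Real.summable_one_div_nat_pow.2 (by norm_num)).sum_le_tsum _ fun _ _ => by positivity
  calc _ ≤ ∑ Γ ∈ S, ∑ y ∈ Contour.base Γ,
        ∑ z ∈ Z, if z ∈ I Γ y then 2 / (k * (Γ.mass : ℝ) ^ 3) * f z else 0 :=
        Finset.sum_le_sum fun Γ hΓ => Finset.sum_le_sum fun y hy => step1 Γ hΓ y hy
    _ = ∑ z ∈ Z, (∑ Γ ∈ S, ∑ y ∈ Contour.base Γ,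
        (if z ∈ I Γ y then (2 : ℝ) / (k * (Γ.mass : ℝ) ^ 3) else 0)) * f z := by
      simp only [Finset.sum_mul, ite_mul, zero_mul]
      symm
      rw [Finset.sum_comm]
      exact Finset.sum_congr rfl fun Γ _ => Finset.sum_comm
    _ ≤ ∑ z ∈ Z, (2 / k * ∑' m : ℕ, 1 / (m : ℝ) ^ 2) * f z :=
      Finset.sum_le_sum fun z _ => mul_le_mul_of_nonneg_right (step2 z) (hf0 z)
    _ ≤ _ := by
      rw [← Finset.mul_sum]
      refine mul_le_mul_of_nonneg_left ?_ (by positivity)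
      exact sum_le_hasSum _ (fun z _ => hf0 z) (hasSum_potential hα T)

/-! ### The interaction of a contour with the other contours -/

/-- At distances beyond `n²` a factor `d ^ (-1/2) ≤ 1 / n` splits off the coupling; what remains is
still summable as long as `α < 1/2`. -/
lemma coupling_le_of_sq_lt {α : ℝ} {n d : ℕ} (hn : 1 ≤ n) (h : n ^ 2 < d) :
    coupling α d ≤ 1 / n * coupling (α + 1 / 2) d := by
  have hn' : (1 : ℝ) ≤ n := by exact_mod_cast hn
  have h' : (n : ℝ) ^ 2 < d := by exact_mod_cast h
  have hd : (0 : ℝ) < d := lt_of_le_of_lt (by positivity) h'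
  have h1 : coupling α d = 1 / √d * coupling (α + 1 / 2) d := by
    rw [coupling, coupling, show -2 + α = -(1 / 2) + (-2 + (α + 1 / 2)) by ring,
      Real.rpow_add hd, Real.rpow_neg hd.le, Real.sqrt_eq_rpow, one_div (_ ^ _)]
  rw [h1]
  refine mul_le_mul_of_nonneg_right ?_ (coupling_nonneg _ _)
  exact one_div_le_one_div_of_le (by positivity) (Real.le_sqrt_of_sq_le h'.le)

/-- The mixed term of the energy: the coupling of the pairs of sites separated by both spin
configurations. -/
noncomputable def mixed (α : ℝ) (σ σ' : ℤ → ℤˣ) (p : ℤ × ℤ) : ℝ :=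
  if σ p.1 ≠ σ p.2 ∧ σ' p.1 ≠ σ' p.2 then coupling α (p.1 - p.2).natAbs else 0

/-- A pair of sites is separated by the product of two spin configurations if it is separated by
exactly one of them. -/
lemma cut_mul (α : ℝ) (σ σ' : ℤ → ℤˣ) (p : ℤ × ℤ) :
    cut α (fun x => σ x * σ' x) p = cut α σ p + cut α σ' p - 2 * mixed α σ σ' p := by
  simp only [cut, mixed]
  rcases Int.units_eq_one_or (σ p.1) with a | a <;>
    rcases Int.units_eq_one_or (σ p.2) with b | b <;>
    rcases Int.units_eq_one_or (σ' p.1) with d | d <;>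
    rcases Int.units_eq_one_or (σ' p.2) with e | e <;> simp [a, b, d, e] <;> ring

lemma tsum_cut_mul {α : ℝ} (hα : α < 1) {τ Γ τ' : Finset Triangle} (hdisj : Disjoint Γ τ')
    (hτ : Γ ∪ τ' = τ) :
    Summable (mixed α (spin Γ) (spin τ')) ∧
    1 / 2 * ∑' p, cut α (spin τ) p - 1 / 2 * ∑' p, cut α (spin τ') p =
      1 / 2 * ∑' p, cut α (spin Γ) p - ∑' p, mixed α (spin Γ) (spin τ') p := by
  have hspin : spin τ = fun x => spin Γ x * spin τ' x := by
    funext x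
    rw [← hτ]
    exact Finset.prod_union hdisj
  have hm : Summable (mixed α (spin Γ) (spin τ')) := by
    refine Summable.of_nonneg_of_le (fun p => ?_) (fun p => ?_) (summable_cut hα Γ)
    · unfold mixed
      split_ifs
      exacts [coupling_nonneg _ _, le_rfl]
    · unfold mixed cut
      split_ifs with h1 h2 h2
      exacts [le_rfl, absurd h1.1 h2, coupling_nonneg _ _, le_rfl]
  refine ⟨hm, ?_⟩
  have h1 : HasSum (cut α (spin τ)) _ :=
    (((summable_cut hα Γ).hasSum.add (summable_cut hα τ').hasSum).sub
      (hm.hasSum.mul_left 2)).congr_fun fun p => by rw [hspin, cut_mul]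
  rw [h1.tsum_eq]
  ring

/-- The interaction of `Γ` with the remaining contours is a small multiple of the norm of `Γ` when
the contours are well separated: a contour of mass at least `|Γ|` is only seen from `Γ` at distances
beyond `(k|Γ|)²`, and the contours of smaller mass are sparse around each triangle of `Γ`. -/
lemma tsum_mixed_le {α C : ℝ} (hα0 : 0 ≤ α) (hα : α < 1 / 2)
    (hC : ∀ L : ℕ, 1 ≤ L → ∑ j ∈ Finset.range L, tail α (j + 1) ≤ C * chi α L)
    {k : ℕ} (hk : 1 ≤ k) {c : ℝ} (hc : 4 * (k : ℝ) ^ 2 ≤ c) {τ : Finset Triangle}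
    (P : Finpartition τ)
    (hP : ∀ Γ ∈ P.parts, ∀ Γ' ∈ P.parts, Γ ≠ Γ' → Contour.WellSeparated c Γ Γ')
    {Γ : Contour} (hΓ : Γ ∈ P.parts)
    (hm : Summable (mixed α (spin Γ) (spin (τ \ Γ)))) :
    ∑' p, mixed α (spin Γ) (spin (τ \ Γ)) p ≤
      2 / k * (tail (α + 1 / 2) 0 + tail (α + 1 / 2) 1 +
        8 * (∑' m : ℕ, 1 / (m : ℝ) ^ 2) * C) * contourNorm α Γ := by
  classical
  have hα1 : α < 1 := by linarith
  have hk' : (1 : ℝ) ≤ k := by exact_mod_cast hk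
  have hne : ∀ Γ ∈ P.parts, Γ.Nonempty := fun Γ h => P.nonempty_of_mem_parts h
  have hM := Contour.one_le_mass (hne Γ hΓ)
  set M := Γ.mass with hMdef
  -- Well separation, with the constants used below.
  have hsep : ∀ A ∈ P.parts, ∀ B ∈ P.parts, A ≠ B → Contour.mass A ≤ Contour.mass B →
      ∀ T ∈ A, ∀ T' ∈ B,
      4 * (k ^ 2 * Contour.mass A ^ 3) < T.dist T' := by
    intro A hA B hB hAB hmass T hT T' hT'
    have h1 := (hP A hA B hB hAB).2 T hT T' hT'
    have h2 : (Contour.mass A : ℝ) ≤ Contour.mass B := by exact_mod_cast hmass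
    rw [min_eq_left h2] at h1
    have h3 : 4 * (k : ℝ) ^ 2 * (Contour.mass A : ℝ) ^ 3 ≤ c * (Contour.mass A : ℝ) ^ 3 := by gcongr
    have h4 : 4 * (k : ℝ) ^ 2 * (Contour.mass A : ℝ) ^ 3 < T.dist T' := h3.trans_lt h1
    have h5 : 4 * k ^ 2 * Contour.mass A ^ 3 < T.dist T' := by exact_mod_cast h4
    linarith
  have hkk : k ≤ k ^ 2 := Nat.le_self_pow (by norm_num) k
  set S : Finset Contour := P.parts.filter fun Γ' => Contour.mass Γ' < M with hS
  have hSP : ∀ Γ' ∈ S, Γ' ∈ P.parts ∧ (Contour.mass Γ') < M := fun Γ' h => Finset.mem_filter.1 h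
  set β := α + 1 / 2 with hβ
  have hβ1 : β < 1 := by linarith
  -- `far` bounds the contribution of the contours of mass at least `M`, and the double sum in `u`
  -- that of the smaller ones; each pair is charged to the component lying in the relevant base.
  set far : ℤ → ℤ → ℝ := fun x y => 1 / (k * M : ℕ) * coupling β (x - y).natAbs with hfar
  set u : ℤ × ℤ → ℝ := fun p => (if p.1 ∈ Contour.base Γ then far p.1 p.2 else 0) +
    ∑ T ∈ Γ, ∑ Γ' ∈ S, if p.1 ∈ Contour.base Γ' then cut α (spin {T}) (p.1, p.2) else 0 with hu
  have hfar0 : ∀ x y, 0 ≤ far x y := fun x y => mul_nonneg (by positivity) (coupling_nonneg _ _)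
  have hu1 : ∀ p : ℤ × ℤ, 0 ≤ if p.1 ∈ Contour.base Γ then far p.1 p.2 else 0 := fun p => by
    split_ifs
    exacts [hfar0 _ _, le_rfl]
  have hu3 : ∀ (p : ℤ × ℤ) (T : Triangle) (Γ' : Contour),
      0 ≤ if p.1 ∈ Contour.base Γ' then cut α (spin {T}) (p.1, p.2) else 0 := fun p T Γ' => by
    split_ifs
    exacts [cut_nonneg _ _ _, le_rfl]
  have hu0 : ∀ p, 0 ≤ u p := fun p =>
    add_nonneg (hu1 p) (Finset.sum_nonneg fun T _ => Finset.sum_nonneg fun Γ' _ => hu3 p T Γ')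
  set U : ℝ := ∑ x ∈ Contour.base Γ, 1 / (k * M : ℕ) * (tail β 0 + tail β 1) +
    ∑ T ∈ Γ, ∑ Γ' ∈ S, ∑ y ∈ Contour.base Γ', potential α T y with hU
  have husum : HasSum u U := by
    refine (hasSum_strip fun x _ => (hasSum_coupling_int hβ1 x).mul_left _).add ?_
    refine hasSum_sum fun T _ => hasSum_sum fun Γ' _ => ?_
    exact hasSum_strip (g := fun x y => cut α (spin {T}) (x, y)) fun y _ =>
      (summable_cut_row hα1 {T} y).hasSum
  have husum' : HasSum (fun p : ℤ × ℤ => u p.swap) U := by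
    rw [← (Equiv.prodComm ℤ ℤ).hasSum_iff] at husum
    exact husum
  have hbig : ∀ T ∈ Γ, ∀ T', (∃ Γ' ∈ P.parts, Γ ≠ Γ' ∧ M ≤ (Contour.mass Γ') ∧ T' ∈ Γ') → ∀ x y,
      x ∈ T.base → spin {T'} x ≠ spin {T'} y → coupling α (x - y).natAbs ≤ u (x, y) := by
    rintro T hT T' ⟨Γ', hΓ', hne', hmass, hT'⟩ x y hx hxy
    have h1 := hsep Γ hΓ Γ' hΓ' hne' hmass T hT T' hT'
    rw [← hMdef] at h1
    have h2 : (k * M) ^ 2 ≤ k ^ 2 * M ^ 3 := by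
      rw [mul_pow]
      exact Nat.mul_le_mul_left _ (Nat.pow_le_pow_right hM (by norm_num))
    have h3 : T.mass ≤ (k * M) ^ 2 :=
      (Triangle.mass_le hT).trans ((Nat.le_mul_of_pos_left _ hk).trans
        (Nat.le_self_pow (by norm_num) _))
    have h4 := lt_natAbs_sub h3 (by omega) hx hxy
    have h5 := coupling_le_of_sq_lt (α := α) (Nat.mul_pos hk hM) h4
    have hxΓ : x ∈ Contour.base Γ := Finset.mem_biUnion.2 ⟨T, hT, hx⟩
    refine h5.trans (le_trans (le_of_eq ?_) (le_add_of_nonneg_right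
      (Finset.sum_nonneg fun T _ => Finset.sum_nonneg fun Γ' _ => hu3 (x, y) T Γ')))
    simp only [hxΓ, if_true, hfar, hβ]
  have hsmall : ∀ T ∈ Γ, ∀ Γ' ∈ S, ∀ x y, x ∈ Contour.base Γ' → spin {T} x ≠ spin {T} y →
      coupling α (x - y).natAbs ≤ u (x, y) := by
    intro T hT Γ' hΓ' x y hx hxy
    refine le_trans ?_ (le_add_of_nonneg_left (hu1 (x, y)))
    refine le_trans ?_ (Finset.single_le_sum (f := fun T => ∑ Γ' ∈ S,
      if x ∈ Contour.base Γ' then cut α (spin {T}) (x, y) else 0)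
      (fun T _ => Finset.sum_nonneg fun Γ' _ => hu3 (x, y) T Γ') hT)
    refine le_trans ?_ (Finset.single_le_sum (f := fun Γ' : Contour =>
      if x ∈ Contour.base Γ' then cut α (spin {T}) (x, y) else 0)
      (fun Γ' _ => hu3 (x, y) T Γ') hΓ')
    simp [hx, cut, hxy]
  have hpoint : ∀ p, mixed α (spin Γ) (spin (τ \ Γ)) p ≤ u p + u p.swap := by
    rintro ⟨x, y⟩
    simp only [mixed, Prod.swap_prod_mk]
    split_ifs with h
    · obtain ⟨T, hT, hTxy⟩ := exists_of_spin_ne h.1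
      obtain ⟨T', hT', hTxy'⟩ := exists_of_spin_ne h.2
      obtain ⟨hT'τ, hT'Γ⟩ := Finset.mem_sdiff.1 hT'
      obtain ⟨Γ', hΓ', hT'Γ'⟩ := P.exists_mem hT'τ
      have hne' : Γ ≠ Γ' := by
        rintro rfl
        exact hT'Γ hT'Γ'
      have hxy1 := hu0 (x, y)
      have hxy2 := hu0 (y, x)
      have hsymm := coupling_symm α x y
      rcases lt_or_ge (Contour.mass Γ') M with hlt | hge
      · have hΓS : Γ' ∈ S := Finset.mem_filter.2 ⟨hΓ', hlt⟩
        by_cases hx : x ∈ T'.base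
        · linarith [hsmall T hT Γ' hΓS x y (Finset.mem_biUnion.2 ⟨T', hT'Γ', hx⟩) hTxy]
        · have hy : y ∈ T'.base := by
            rw [spin_singleton_ne_iff] at hTxy'
            tauto
          linarith [hsmall T hT Γ' hΓS y x (Finset.mem_biUnion.2 ⟨T', hT'Γ', hy⟩) hTxy.symm]
      · by_cases hx : x ∈ T.base
        · linarith [hbig T hT T' ⟨Γ', hΓ', hne', hge, hT'Γ'⟩ x y hx hTxy']
        · have hy : y ∈ T.base := by
            rw [spin_singleton_ne_iff] at hTxy
            tauto
          linarith [hbig T hT T' ⟨Γ', hΓ', hne', hge, hT'Γ'⟩ y x hy hTxy'.symm]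
    · exact add_nonneg (hu0 _) (hu0 _)
  have hle : ∑' p, mixed α (spin Γ) (spin (τ \ Γ)) p ≤ U + U :=
    hasSum_le hpoint hm.hasSum (husum.add husum')
  have hnorm : 1 ≤ contourNorm α Γ := by
    obtain ⟨T, hT⟩ := hne Γ hΓ
    exact (one_le_chi hα0 T.one_le_mass).trans (Finset.single_le_sum
      (f := fun T : Triangle => chi α T.mass)
      (fun T _ => zero_le_one.trans (one_le_chi hα0 T.one_le_mass)) hT)
  set B := ∑' m : ℕ, 1 / (m : ℝ) ^ 2 with hB
  have hB0 : 0 ≤ B := tsum_nonneg fun m => by positivity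
  have hU1 : ∑ x ∈ Contour.base Γ, 1 / (k * M : ℕ) * (tail β 0 + tail β 1) ≤
      1 / k * (tail β 0 + tail β 1) * contourNorm α Γ := by
    have ht : 0 ≤ tail β 0 + tail β 1 := add_nonneg (tail_nonneg _ _) (tail_nonneg _ _)
    have hM' : (1 : ℝ) ≤ M := by exact_mod_cast hM
    have hcard : ((Contour.base Γ).card : ℝ) ≤ M := by exact_mod_cast Contour.card_base_le Γ
    rw [Finset.sum_const, nsmul_eq_mul]
    calc _ ≤ (M : ℝ) * (1 / (k * M : ℕ) * (tail β 0 + tail β 1)) := by gcongr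
      _ = 1 / k * (tail β 0 + tail β 1) * 1 := by push_cast; field_simp
      _ ≤ _ := by gcongr
  have hU2 : ∑ T ∈ Γ, ∑ Γ' ∈ S, ∑ y ∈ Contour.base Γ', potential α T y ≤
      1 / k * (8 * B * C) * contourNorm α Γ := by
    rw [contourNorm, Finset.mul_sum]
    refine Finset.sum_le_sum fun T hT => ?_
    have h1 := sum_potential_le hα0 hα1 (T := T) hk (S := S) (fun Γ' h => hne _ (hSP Γ' h).1)
      (fun Γ' h T' hT' => by
        have h2 := hsep Γ' (hSP Γ' h).1 Γ hΓ (fun he => (hSP Γ' h).2.ne (by rw [he]))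
          (hSP Γ' h).2.le T' hT' T hT
        have h3 := Nat.mul_le_mul_right ((Contour.mass Γ') ^ 3) hkk
        omega)
      (fun A hA A' hA' hmass hAA' T hT T' hT' => by
        have h2 := hsep A (hSP A hA).1 A' (hSP A' hA').1 hAA' hmass.le T hT T' hT'
        have h3 := Nat.mul_le_mul_right (Contour.mass A ^ 3) hkk
        omega)
    refine h1.trans ?_
    calc _ ≤ 2 / k * B * (4 * (C * chi α T.mass)) := by
          gcongr
          exact hC _ T.one_le_mass
      _ = _ := by ring
  calc _ ≤ U + U := hle
    _ ≤ (1 / k * (tail β 0 + tail β 1) * contourNorm α Γ +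
          1 / k * (8 * B * C) * contourNorm α Γ) * 2 := by rw [hU]; linarith
    _ = _ := by ring

/-- The energy of a contour is at least the sum of `W` over the masses of its triangles. -/
lemma contourNorm_le_tsum_cut {α ζ : ℝ} (hα : α < 1)
    (hW : ∀ L : ℕ, 1 ≤ L → ζ * chi α L ≤ W α L) {r : ℤ → ℝ} (hr : IsRootChoice r) {F : Finset ℤ}
    {τ : Finset Triangle} (h : Grows r F τ) {Γ : Contour} (hΓ : Γ ⊆ τ) :
    ζ * contourNorm α Γ ≤ 1 / 2 * ∑' p, cut α (spin Γ) p := by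
  obtain ⟨F', -, hF'⟩ := h.subset Γ hΓ
  refine le_trans ?_ (hF'.sum_W_le hα hr)
  rw [contourNorm, Finset.mul_sum]
  exact Finset.sum_le_sum fun T _ => hW _ T.one_le_mass

end DysonIsing

open DysonIsing
theorem mainTheorem3
    (αs : ℝ) (hαs0 : 0 < αs) (hαs1 : αs < 1)
    (hαs : ∑' n : ℕ, 1 / ((n : ℝ) + 1) ^ (2 - αs) = 2)
    (α : ℝ) (hα0 : 0 ≤ α) (hα : α < αs) :
    ∃ ζ : ℝ, 0 < ζ ∧
      (∀ L : ℕ, 1 ≤ L → ζ * chi α L ≤ W α L) ∧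
      ∃ c₀ : ℝ, 1 < c₀ ∧ ∀ c : ℝ, c₀ ≤ c →
        ∀ r : ℤ → ℝ, IsRootChoice r →
        ∀ N : ℕ, 1 ≤ N →
        ∀ G : (τ : Finset Triangle) → Finpartition τ, IsContourMap c r N G →
        ∀ τ : Finset Triangle, IsCompatible r N τ →
        ∀ Γ ∈ (G τ).parts,
          ζ * contourNorm α Γ ≤ energy α {Γ} ∧
          ζ / 2 * contourNorm α Γ ≤ condEnergy α Γ (G τ).parts := by
  have htail : tail αs 1 = 2 := by
    rw [← hαs]
    refine tsum_congr fun n => ?_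
    rw [coupling, show -2 + αs = -(2 - αs) by ring, Real.rpow_neg (by positivity), one_div]
    push_cast; rfl
  have hα1 : α < 1 := hα.trans hαs1
  have hα2 : α < 1 / 2 := by linarith [exponent_le hαs1 htail]
  obtain ⟨ζ, hζ0, hζ⟩ := exists_chi_le_halfW hα0 hα hαs1 htail
  have hW : ∀ L : ℕ, 1 ≤ L → ζ * chi α L ≤ W α L := fun L hL => by
    have h1 := hζ L hL
    have h2 := mul_nonneg hζ0.le (zero_le_one.trans (one_le_chi hα0 hL))
    rw [W_eq hα1]
    linarith
  obtain ⟨C, hC0, hC⟩ := exists_sum_tail_le hα0 hα1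
  set K : ℝ := tail (α + 1 / 2) 0 + tail (α + 1 / 2) 1 + 8 * (∑' m : ℕ, 1 / (m : ℝ) ^ 2) * C
    with hK
  -- The scale `k` is chosen so that the mixed term is at most `ζ / 2` times the norm.
  obtain ⟨k, hk⟩ := exists_nat_ge (max 1 (4 * K / ζ))
  have hk1 : (1 : ℝ) ≤ k := (le_max_left _ _).trans hk
  have hk2 : 2 / k * K ≤ ζ / 2 := by
    have := (le_max_right _ _).trans hk
    rw [div_le_iff₀ hζ0] at this
    rw [div_mul_eq_mul_div, div_le_iff₀ (by positivity)]
    linarith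
  refine ⟨ζ, hζ0, hW, 4 * (k : ℝ) ^ 2, by nlinarith, ?_⟩
  intro c hc r hr N _ G hG τ hτ Γ hΓ
  obtain ⟨σ, -, hgrow⟩ := id hτ
  have hΓτ : Γ ⊆ τ := (G τ).le hΓ
  have hE := contourNorm_le_tsum_cut hα1 hW hr hgrow hΓτ
  refine ⟨?_, ?_⟩
  · rw [energy_eq, Finset.singleton_biUnion]
    exact hE
  · have hparts : (G τ).parts.biUnion id = τ := by
      rw [← Finset.sup_eq_biUnion]
      exact (G τ).sup_parts
    have hrest : ((G τ).parts \ {Γ}).biUnion id = τ \ Γ := by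
      ext T
      simp only [Finset.mem_biUnion, Finset.mem_sdiff, Finset.mem_singleton, id]
      constructor
      · rintro ⟨Γ', ⟨hΓ', hne⟩, hT⟩
        exact ⟨(G τ).le hΓ' hT, fun hTΓ => hne ((G τ).eq_of_mem_parts hΓ' hΓ hT hTΓ)⟩
      · rintro ⟨hT, hTΓ⟩
        obtain ⟨Γ', hΓ', hTΓ'⟩ := (G τ).exists_mem hT
        exact ⟨Γ', ⟨hΓ', fun h => hTΓ (h ▸ hTΓ')⟩, hTΓ'⟩
    obtain ⟨hm, hsplit⟩ := tsum_cut_mul hα1 (Finset.disjoint_sdiff (s := Γ) (t := τ))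
      (Finset.union_sdiff_of_subset hΓτ)
    have hX := tsum_mixed_le hα0 hα2 hC (by exact_mod_cast hk1) hc (G τ) (hG.separated τ hτ) hΓ hm
    have hnorm : 0 ≤ contourNorm α Γ :=
      Finset.sum_nonneg fun T _ => zero_le_one.trans (one_le_chi hα0 T.one_le_mass)
    have h1 := mul_le_mul_of_nonneg_right hk2 hnorm
    rw [condEnergy, energy_eq, energy_eq, hparts, hrest, hsplit]
    linarith
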